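/- Let $k$ be a field of characteristic $2$. **Conventions.** For an algebra endomorphism $\tau$ of a $k$-algebra $A$ and a $\tau$-derivation $\delta$ (that is, $\delta$ is $k$-linear and $\delta(ab)=\tau(a)\delta(b)+\delta(a)b$), the Ore extension $A[z;\tau,\delta]$ is the algebra generated by $A$ and $z$ with the relations $za=\tau(a)z+\delta(a)$, $a\in A$. If $A$ is a Hopf algebra, a *generalized Hopf-Ore extension* of $A$, determined by $(r_1,r_2,x,y)\in A^4$, is a Hopf algebra structure on an Ore extension $H=A[z;\tau,\delta]$ such that $A$ is a Hopf subalgebra and $\Delta z=z\otimes r_1+x\otimes y+r_2\otimes z$. It is *normalized* if $r_1,r_2$ are group-like, $\Delta x=x\otimes 1+r_2\otimes x$, $\Delta y=y\otimes r_1+1\otimes y$, and $x=0$ if and only if $y=0$. A normalized one with $\tau(a)=\sum\chi(a_1)r_1a_2r_1^{-1}$ for an algebra map $\chi:A\to k$ is denoted by $A(\chi,r_1,r_2,x,y,\delta)$. Two generalized Hopf-Ore extensions $H$ of $A$ and $H'$ of $A'$ are isomorphic if there is a Hopf algebra isomorphism $H\to H'$ taking $A$ onto $A'$. For a Lie algebra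 $\mathfrak g$ over $k$, $U(\mathfrak g)$ carries the Hopf algebra structure in which the elements of $\mathfrak g$ are primitive, and $\hat{\mathfrak g}\subseteq U(\mathfrak g)$ is the span of all $u^{2^r}$, $u\in\mathfrak g$, $r\ge 0$. In $U(\mathfrak g)$ we write $[u,v]=uv-vu$. A character of $U(\mathfrak g)$ that vanishes on $\mathfrak g$ is written $\chi=0$. **Proposition.** Let $\mathfrak g$ be a $2$-dimensional Lie algebra over $k$. 1. If a generalized Hopf-Ore extension of $U(\mathfrak g)$ is determined by $(r_1,r_2,x,y)$, then $r_1=r_2=1$; if it is normalized, then $x,y\in\hat{\mathfrak g}$. 2. $\mathfrak g$ has a basis $\{a,b\}$ with $[a,b]=0$ or $[a,b]=a$. For every such basis, every generalized Hopf-Ore extension of $U(\mathfrak g)$ is isomorphic to a generalized Hopf-Ore extension of $U(\mathfrak g)$ in one of the following families. In (c) and (d), write $x=\sum_i\alpha_i a^{2^i}+\sum_i\alpha_i' b^{2^i}$, $y=\sum_i\beta_i a^{2^i}+\sum_i\beta'_i b^{2^i}$ (finite sums, coefficients in $k$) and $\alpha'=\sum_i\alpha'_i$, $\beta'=\sum_i\beta'_i$.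 (a) $U(\mathfrak g)(\chi,1,1,0,0,\delta)$ with $[a,b]=0$ or $[a,b]=a$, $\delta(\mathfrak g)\subseteq\hat{\mathfrak g}$ and $\delta([a,b])=[\delta(a),b]+[a,\delta(b)]+\chi(a)\delta(b)-\chi(b)\delta(a)$. (b) $U(\mathfrak g)(0,1,1,x,y,\delta)$ with $[a,b]=0$, $x,y\in\hat{\mathfrak g}\setminus\{0\}$ and $\delta(\mathfrak g)\subseteq\hat{\mathfrak g}$. (c) $U(\mathfrak g)(0,1,1,x,y,\delta)$ with $[a,b]=a$, $x,y\in\hat{\mathfrak g}\setminus\{0\}$, $\alpha_0y=\beta_0x$, $\alpha'y=\beta'x$, $\delta(a)=[\delta(a),b]+[a,\delta(b)]$, and either (i) $x=\alpha_0a$ (hence $y=\beta_0a$) and $\delta(\mathfrak g)\subseteq\hat{\mathfrak g}$, or (ii) $x\ne\alpha_0a$ and $\delta(a)-\beta'ax\in\hat{\mathfrak g}$, $\delta(b)-\beta_0ax\in\hat{\mathfrak g}$. (d) $U(\mathfrak g)(\chi,1,1,x,y,\delta)$ with $[a,b]=a$, $\chi(a)=0$, $\chi(b)=1$, $x,y\in\hat{\mathfrak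 g}\setminus\{0\}$, $\delta(\mathfrak g)\subseteq\hat{\mathfrak g}$, $[\delta(a),b]+[a,\delta(b)]=0$, and either (i) $x=\alpha_0a$ and $\beta_0=\beta'=0$, or (ii) $\alpha_0=\alpha'=0$ and $y=\beta_0a$. 3. The members of family (a) with $\delta(\mathfrak g)\subseteq\mathfrak g$ are exactly the enveloping algebras of the $3$-dimensional Lie algebras containing $\mathfrak g$: for each such member $H$ there are a $3$-dimensional Lie algebra $L$, an injective Lie algebra map $j:\mathfrak g\to L$ and a Hopf algebra isomorphism $H\to U(L)$ that restricts to $j$ on $\mathfrak g$; and conversely, for every injective Lie algebra map $j:\mathfrak g\to L$ with $\dim L=3$ there is such a member $H$ with such an isomorphism $H\to U(L)$. -/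

import Mathlib

open scoped TensorProduct

universe u v w t

noncomputable section

/-! ### The Hopf algebra structure on a universal enveloping algebra -/

namespace UEAHopf

attribute [local instance 100] LieRing.ofAssociativeRing

variable (k : Type u) [CommRing k] (g : Type v) [LieRing g] [LieAlgebra k g]

local notation "U" => UniversalEnvelopingAlgebra k g
local notation "ιU" => UniversalEnvelopingAlgebra.ι k

/-- The comultiplication of `U(g)`: the algebra map with `u ↦ u ⊗ 1 + 1 ⊗ u` for `u` in `g`. -/
def comulHom : U →ₐ[k] U ⊗[k] U :=
  UniversalEnvelopingAlgebra.lift k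
    { toFun := fun u => (ιU u : U) ⊗ₜ[k] (1 : U) + (1 : U) ⊗ₜ[k] (ιU u : U)
      map_add' := by
        intro x y
        simp only [map_add, TensorProduct.add_tmul, TensorProduct.tmul_add]
        abel
      map_smul' := by
        intro c x
        simp [TensorProduct.smul_tmul']
      map_lie' := by
        intro x y
        simp only [LieHom.map_lie, LieRing.of_associative_ring_bracket, TensorProduct.sub_tmul,
          TensorProduct.tmul_sub, mul_add, add_mul, Algebra.TensorProduct.tmul_mul_tmul,
          mul_one, one_mul]
        abel }

/-- The counit of `U(g)`: the algebra map that vanishes on `g`. -/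
def counitHom : U →ₐ[k] k :=
  UniversalEnvelopingAlgebra.lift k
    { toFun := fun _ => 0
      map_add' := by simp
      map_smul' := by simp
      map_lie' := by simp }

/-- The antipode of `U(g)`, as an algebra map to the opposite algebra, with `u ↦ -u` on `g`. -/
def antipodeHom : U →ₐ[k] (U)ᵐᵒᵖ :=
  UniversalEnvelopingAlgebra.lift k
    { toFun := fun u => MulOpposite.op (-(ιU u : U))
      map_add' := by
        intro x y
        apply MulOpposite.unop_injective
        simp only [map_add, MulOpposite.unop_op, MulOpposite.unop_add]
        abel
      map_smul' := by
        intro c x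
        apply MulOpposite.unop_injective
        simp
      map_lie' := by
        intro x y
        apply MulOpposite.unop_injective
        simp [LieRing.of_associative_ring_bracket] }

variable {k g}

@[simp] theorem comulHom_ι (u : g) :
    comulHom k g (ιU u) = (ιU u : U) ⊗ₜ[k] (1 : U) + (1 : U) ⊗ₜ[k] (ιU u : U) :=
  UniversalEnvelopingAlgebra.lift_ι_apply _ _ _

@[simp] theorem counitHom_ι (u : g) : counitHom k g (ιU u) = 0 :=
  UniversalEnvelopingAlgebra.lift_ι_apply _ _ _

@[simp] theorem antipodeHom_ι (u : g) :
    antipodeHom k g (ιU u) = MulOpposite.op (-(ιU u : U)) :=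
  UniversalEnvelopingAlgebra.lift_ι_apply _ _ _

theorem mem_of_forall_ι (B : Subalgebra k U) (h : ∀ u : g, (ιU u : U) ∈ B) (w : U) : w ∈ B := by
  let f : g →ₗ⁅k⁆ B :=
    { toFun := fun u => ⟨ιU u, h u⟩
      map_add' := by intro x y; ext; simp
      map_smul' := by intro c x; ext; simp
      map_lie' := by
        intro x y
        apply Subtype.ext
        simp [LieRing.of_associative_ring_bracket] }
  have : B.val.comp (UniversalEnvelopingAlgebra.lift k f) = AlgHom.id k U := by
    apply UniversalEnvelopingAlgebra.hom_ext
    ext u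
    have := UniversalEnvelopingAlgebra.lift_ι_apply k f u
    change ((UniversalEnvelopingAlgebra.lift k f (ιU u) : B) : U) = ιU u
    rw [this]
    rfl
  have h2 := DFunLike.congr_fun this w
  rw [← show B.val (UniversalEnvelopingAlgebra.lift k f w) = w from h2]
  exact (UniversalEnvelopingAlgebra.lift k f w).2

theorem algHom_ext {A : Type*} [Ring A] [Algebra k A] {F G : U →ₐ[k] A}
    (h : ∀ u : g, F (ιU u) = G (ιU u)) : F = G :=
  UniversalEnvelopingAlgebra.hom_ext k (LieHom.ext h)

instance instBialgebra : Bialgebra k U :=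
  Bialgebra.ofAlgHom (comulHom k g) (counitHom k g)
    (by
      apply algHom_ext
      intro u
      simp [-UniversalEnvelopingAlgebra.ι_apply, TensorProduct.add_tmul, TensorProduct.tmul_add,
        Algebra.TensorProduct.one_def, add_assoc])
    (by
      apply algHom_ext
      intro u
      simp [-UniversalEnvelopingAlgebra.ι_apply])
    (by
      apply algHom_ext
      intro u
      simp [-UniversalEnvelopingAlgebra.ι_apply])

theorem comul_eq (w : U) : Coalgebra.comul (R := k) w = comulHom k g w := rfl
theorem counit_eq (w : U) : Coalgebra.counit (R := k) w = counitHom k g w := rfl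

/-- The antipode of `U(g)` as a linear map. -/
def antipodeLin : U →ₗ[k] U :=
  (MulOpposite.opLinearEquiv k).symm.toLinearMap ∘ₗ (antipodeHom k g).toLinearMap

theorem antipodeLin_mul (p q : U) :
    antipodeLin (p * q) = antipodeLin q * antipodeLin (k := k) (g := g) p := by
  simp [antipodeLin]

theorem antipodeLin_ι (u : g) : antipodeLin (ιU u) = -(ιU u : U) := by
  simp only [antipodeLin, LinearMap.comp_apply, AlgHom.toLinearMap_apply, antipodeHom_ι]
  rfl

theorem antipodeLin_one : antipodeLin (1 : U) = 1 := by
  simp [antipodeLin]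

theorem antipode_left (w : U) (s : U ⊗[k] U) :
    LinearMap.mul' k U (antipodeLin.rTensor U (comulHom k g w * s)) =
      counitHom k g w • LinearMap.mul' k U (antipodeLin.rTensor U s) := by
  let B : Subalgebra k U :=
    { carrier := {w | ∀ s : U ⊗[k] U,
        LinearMap.mul' k U (antipodeLin.rTensor U (comulHom k g w * s)) =
          counitHom k g w • LinearMap.mul' k U (antipodeLin.rTensor U s)}
      mul_mem' := by
        intro a b ha hb s
        simp only [Set.mem_ofPred_eq] at ha hb
        rw [map_mul (comulHom k g), mul_assoc, ha, hb, map_mul (counitHom k g), mul_smul]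
      add_mem' := by
        intro a b ha hb s
        simp only [Set.mem_ofPred_eq] at ha hb
        rw [map_add, add_mul, map_add, map_add, ha, hb, map_add, add_smul]
      algebraMap_mem' := by
        intro c s
        rw [AlgHom.commutes, AlgHom.commutes, ← Algebra.smul_def, map_smul, map_smul]
        rfl }
  refine mem_of_forall_ι B (fun u => ?_) w s
  intro s
  rw [comulHom_ι, counitHom_ι, zero_smul]
  induction s using TensorProduct.induction_on with
  | zero => simp
  | add p q hp hq => rw [mul_add, map_add, map_add, hp, hq, add_zero]
  | tmul p q =>
    simp [-UniversalEnvelopingAlgebra.ι_apply, add_mul, antipodeLin_mul, antipodeLin_ι, mul_assoc]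

theorem antipode_right (w : U) (s : U ⊗[k] U) :
    LinearMap.mul' k U (antipodeLin.lTensor U (s * comulHom k g w)) =
      counitHom k g w • LinearMap.mul' k U (antipodeLin.lTensor U s) := by
  let B : Subalgebra k U :=
    { carrier := {w | ∀ s : U ⊗[k] U,
        LinearMap.mul' k U (antipodeLin.lTensor U (s * comulHom k g w)) =
          counitHom k g w • LinearMap.mul' k U (antipodeLin.lTensor U s)}
      mul_mem' := by
        intro a b ha hb s
        simp only [Set.mem_ofPred_eq] at ha hb
        rw [map_mul (comulHom k g), ← mul_assoc, hb, ha, map_mul (counitHom k g), mul_comm, mul_smul]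
      add_mem' := by
        intro a b ha hb s
        simp only [Set.mem_ofPred_eq] at ha hb
        rw [map_add, mul_add, map_add, map_add, ha, hb, map_add, add_smul]
      algebraMap_mem' := by
        intro c s
        rw [AlgHom.commutes, AlgHom.commutes, ← Algebra.commutes, ← Algebra.smul_def,
          map_smul, map_smul]
        rfl }
  refine mem_of_forall_ι B (fun u => ?_) w s
  intro s
  rw [comulHom_ι, counitHom_ι, zero_smul]
  induction s using TensorProduct.induction_on with
  | zero => simp
  | add p q hp hq => rw [add_mul, map_add, map_add, hp, hq, add_zero]
  | tmul p q =>
    simp [-UniversalEnvelopingAlgebra.ι_apply, mul_add, antipodeLin_mul, antipodeLin_ι, mul_assoc]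

/-- The usual Hopf algebra structure on `U(g)`, in which the elements of `g` are primitive. -/
instance instHopfAlgebra : HopfAlgebra k U where
  antipode := antipodeLin
  mul_antipode_rTensor_comul := by
    ext w
    have := antipode_left (k := k) (g := g) w 1
    rw [mul_one, Algebra.TensorProduct.one_def, LinearMap.rTensor_tmul, antipodeLin_one,
      LinearMap.mul'_apply, mul_one] at this
    simpa [comul_eq, counit_eq, Algebra.algebraMap_eq_smul_one] using this
  mul_antipode_lTensor_comul := by
    ext w
    have := antipode_right (k := k) (g := g) w 1
    rw [one_mul, Algebra.TensorProduct.one_def, LinearMap.lTensor_tmul, antipodeLin_one,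
      LinearMap.mul'_apply, mul_one] at this
    simpa [comul_eq, counit_eq, Algebra.algebraMap_eq_smul_one] using this

end UEAHopf

/-! ### Ore extensions -/

/-- The defining relations of `A[z; τ, δ]` on the free algebra with one generator `some a` for each
`a` in `A` and the generator `none` for the variable `z`: the first three make `a ↦ some a` an
algebra map, the last one is `z a = τ(a) z + δ(a)`. -/
inductive OreExtension.Rel {k : Type u} {A : Type v} [CommRing k] [Ring A] [Algebra k A]
    (τ : A →ₐ[k] A) (δ : A →ₗ[k] A) :
    FreeAlgebra k (Option A) → FreeAlgebra k (Option A) → Prop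
  | add (a b : A) : OreExtension.Rel τ δ (FreeAlgebra.ι k (some (a + b)))
      (FreeAlgebra.ι k (some a) + FreeAlgebra.ι k (some b))
  | mul (a b : A) : OreExtension.Rel τ δ (FreeAlgebra.ι k (some (a * b)))
      (FreeAlgebra.ι k (some a) * FreeAlgebra.ι k (some b))
  | scalar (c : k) : OreExtension.Rel τ δ (FreeAlgebra.ι k (some (algebraMap k A c)))
      (algebraMap k (FreeAlgebra k (Option A)) c)
  | ore (a : A) : OreExtension.Rel τ δ (FreeAlgebra.ι k none * FreeAlgebra.ι k (some a))
      (FreeAlgebra.ι k (some (τ a)) * FreeAlgebra.ι k none + FreeAlgebra.ι k (some (δ a)))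

/-- The Ore extension `A[z; τ, δ]`: the algebra generated by the algebra `A` and a variable `z` with
the relations `z a = τ(a) z + δ(a)` (used for a `τ`-derivation `δ`). -/
def OreExtension {k : Type u} {A : Type v} [CommRing k] [Ring A] [Algebra k A]
    (τ : A →ₐ[k] A) (δ : A →ₗ[k] A) : Type (max u v) :=
  RingQuot (OreExtension.Rel τ δ)

namespace OreExtension

variable {k : Type u} {A : Type v} [CommRing k] [Ring A] [Algebra k A]
  (τ : A →ₐ[k] A) (δ : A →ₗ[k] A)

instance : Ring (OreExtension τ δ) := inferInstanceAs (Ring (RingQuot (OreExtension.Rel τ δ)))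

instance : Algebra k (OreExtension τ δ) :=
  inferInstanceAs (Algebra k (RingQuot (OreExtension.Rel τ δ)))

/-- The quotient map from the free algebra. -/
def mk : FreeAlgebra k (Option A) →ₐ[k] OreExtension τ δ :=
  RingQuot.mkAlgHom k (OreExtension.Rel τ δ)

theorem mk_rel {p q : FreeAlgebra k (Option A)} (h : OreExtension.Rel τ δ p q) :
    mk τ δ p = mk τ δ q :=
  RingQuot.mkAlgHom_rel k h

/-- The variable `z`. -/
def z : OreExtension τ δ := mk τ δ (FreeAlgebra.ι k none)

/-- The structure map `A → A[z; τ, δ]`. -/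
def of : A →ₐ[k] OreExtension τ δ where
  toFun a := mk τ δ (FreeAlgebra.ι k (some a))
  map_one' := by
    have h := mk_rel τ δ (OreExtension.Rel.scalar (1 : k))
    simpa using h
  map_mul' a b := by
    have h := mk_rel τ δ (OreExtension.Rel.mul a b)
    simpa using h
  map_zero' := by
    have h := mk_rel τ δ (OreExtension.Rel.scalar (0 : k))
    simpa using h
  map_add' a b := by
    have h := mk_rel τ δ (OreExtension.Rel.add a b)
    simpa using h
  commutes' c := by
    have h := mk_rel τ δ (OreExtension.Rel.scalar c)
    simpa using h

end OreExtension

/-! ### Generalized Hopf-Ore extensions -/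

/-- A generalized Hopf-Ore extension of the Hopf algebra `A`: a Hopf algebra `carrier` whose
underlying algebra is (identified by `e` with) an Ore extension `A[z; τ, δ]`, such that `A` is a
Hopf subalgebra and `Δ z = z ⊗ r₁ + x ⊗ y + r₂ ⊗ z` with `r₁, r₂, x, y` in `A`. -/
structure GeneralizedHopfOreExtension (k : Type u) (A : Type v) [Field k] [Ring A]
    [HopfAlgebra k A] where
  τ : A →ₐ[k] A
  δ : A →ₗ[k] A
  δ_mul : ∀ a b : A, δ (a * b) = τ a * δ b + δ a * b
  carrier : Type w
  [ring : Ring carrier]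
  [hopf : HopfAlgebra k carrier]
  e : OreExtension τ δ ≃ₐ[k] carrier
  r₁ : A
  r₂ : A
  x : A
  y : A
  counit_of : ∀ a : A, Coalgebra.counit (R := k) (e (OreExtension.of τ δ a)) =
    Coalgebra.counit (R := k) a
  comul_of : ∀ a : A, Coalgebra.comul (R := k) (e (OreExtension.of τ δ a)) =
    TensorProduct.map (e.toAlgHom.comp (OreExtension.of τ δ)).toLinearMap
      (e.toAlgHom.comp (OreExtension.of τ δ)).toLinearMap (Coalgebra.comul (R := k) a)
  comul_z : Coalgebra.comul (R := k) (e (OreExtension.z τ δ)) =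
    e (OreExtension.z τ δ) ⊗ₜ[k] e (OreExtension.of τ δ r₁)
      + e (OreExtension.of τ δ x) ⊗ₜ[k] e (OreExtension.of τ δ y)
      + e (OreExtension.of τ δ r₂) ⊗ₜ[k] e (OreExtension.z τ δ)

/-- An element `a` is `(r, s)`-primitive if `Δ a = a ⊗ r + s ⊗ a`. -/
def IsSkewPrimitive (k : Type u) {A : Type v} [Field k] [Ring A] [HopfAlgebra k A]
    (r s a : A) : Prop :=
  Coalgebra.comul (R := k) a = a ⊗ₜ[k] r + s ⊗ₜ[k] a

/-- For a character `χ` and a group-like element `r`, the map `a ↦ ∑ χ(a₁) r a₂ S(r)`. -/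
def characterTwist {k : Type u} {A : Type v} [Field k] [Ring A] [HopfAlgebra k A]
    (χ : A →ₐ[k] k) (r : A) : A →ₗ[k] A :=
  (TensorProduct.lid k A).toLinearMap ∘ₗ
    TensorProduct.map χ.toLinearMap
      (LinearMap.mulRight k (HopfAlgebra.antipode k r) ∘ₗ LinearMap.mulLeft k r) ∘ₗ
    Coalgebra.comul (R := k)

namespace GeneralizedHopfOreExtension

attribute [instance] GeneralizedHopfOreExtension.ring GeneralizedHopfOreExtension.hopf

variable {k : Type u} [Field k] {A : Type v} [Ring A] [HopfAlgebra k A]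

/-- The embedding of `A` in the extension. -/
def incl (E : GeneralizedHopfOreExtension.{u, v, w} k A) : A →ₐ[k] E.carrier :=
  E.e.toAlgHom.comp (OreExtension.of E.τ E.δ)

/-- The normalization convention for the quadruple `(r₁, r₂, x, y)`: `r₁, r₂` are group-like, `x` is
`(1, r₂)`-primitive, `y` is `(r₁, 1)`-primitive, and `x = 0` if and only if `y = 0`. -/
structure IsNormalized (E : GeneralizedHopfOreExtension.{u, v, w} k A) : Prop where
  groupLike₁ : IsGroupLikeElem k E.r₁
  groupLike₂ : IsGroupLikeElem k E.r₂
  primitive_x : IsSkewPrimitive k 1 E.r₂ E.x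
  primitive_y : IsSkewPrimitive k E.r₁ 1 E.y
  x_eq_zero_iff : E.x = 0 ↔ E.y = 0

/-- `E.HasForm χ r₁ r₂ x y` says that `E` is the generalized Hopf-Ore extension
`A(χ, r₁, r₂, x, y, δ)` with `δ = E.δ`: the quadruple of `E` is `(r₁, r₂, x, y)`, it is normalized,
and `τ(a) = ∑ χ(a₁) r₁ a₂ r₁⁻¹`. -/
structure HasForm (E : GeneralizedHopfOreExtension.{u, v, w} k A)
    (χ : A →ₐ[k] k) (r₁ r₂ x y : A) : Prop where
  r₁_eq : E.r₁ = r₁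
  r₂_eq : E.r₂ = r₂
  x_eq : E.x = x
  y_eq : E.y = y
  normalized : E.IsNormalized
  τ_eq : ∀ a : A, E.τ a = characterTwist χ r₁ a

/-- Isomorphism of generalized Hopf-Ore extensions (of possibly different Hopf algebras): a Hopf
algebra isomorphism that takes `A` onto `A'`. (A bialgebra isomorphism of Hopf algebras
automatically commutes with the antipodes.) -/
def Isomorphic {A' : Type t} [Ring A'] [HopfAlgebra k A']
    (E : GeneralizedHopfOreExtension.{u, v, w} k A)
    (E' : GeneralizedHopfOreExtension.{u, t, w} k A') : Prop :=
  ∃ Ψ : E.carrier ≃ₐc[k] E'.carrier, (fun h => Ψ h) '' Set.range E.incl = Set.range E'.incl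

end GeneralizedHopfOreExtension

/-! ### The families over `U(g)` in characteristic `2` -/

/-- The span `ĝ` in `U(g)` of all `u ^ (p ^ r)` with `u` in `g` and `r ≥ 0`. -/
def restrictedHull (k : Type u) [Field k] (g : Type v) [LieRing g] [LieAlgebra k g] (p : ℕ) :
    Submodule k (UniversalEnvelopingAlgebra k g) :=
  Submodule.span k {w | ∃ (u : g) (r : ℕ), w = UniversalEnvelopingAlgebra.ι k u ^ p ^ r}

namespace HopfOreChar2

variable {k : Type u} [Field k] {g : Type v} [LieRing g] [LieAlgebra k g]

local notation "U" => UniversalEnvelopingAlgebra k g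
local notation "ιU" => UniversalEnvelopingAlgebra.ι k
local notation "ĝ" => restrictedHull k g 2

/-- The element `∑ αᵢ a^(2^i) + ∑ α'ᵢ b^(2^i)` of `U(g)`. -/
def combination (a b : g) (α α' : ℕ →₀ k) : U :=
  α.sum (fun i c => c • (ιU a : U) ^ 2 ^ i) + α'.sum (fun i c => c • (ιU b : U) ^ 2 ^ i)

/-- The sum of all the coefficients. -/
def coeffSum (α : ℕ →₀ k) : k := α.sum fun _ c => c

/-- Family (a): `U(g)(χ, 1, 1, 0, 0, δ)`, `δ(g) ⊆ ĝ`,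
`δ([a,b]) = [δ(a), b] + [a, δ(b)] + χ(a) δ(b) - χ(b) δ(a)`. -/
def FamilyA (a b : g) (E : GeneralizedHopfOreExtension.{u, max u v, w} k U) : Prop :=
  ∃ χ : U →ₐ[k] k, E.HasForm χ 1 1 0 0 ∧ (∀ u : g, E.δ (ιU u) ∈ ĝ) ∧
    E.δ (ιU ⁅a, b⁆) =
      (E.δ (ιU a) * ιU b - ιU b * E.δ (ιU a)) + (ιU a * E.δ (ιU b) - E.δ (ιU b) * ιU a)
        + χ (ιU a) • E.δ (ιU b) - χ (ιU b) • E.δ (ιU a)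

/-- Family (b): `[a,b] = 0`, `U(g)(0, 1, 1, x, y, δ)` with `x, y ∈ ĝ` nonzero, `δ(g) ⊆ ĝ`.
The character `0` is the one that vanishes on `g`. -/
def FamilyB (a b : g) (E : GeneralizedHopfOreExtension.{u, max u v, w} k U) : Prop :=
  ⁅a, b⁆ = 0 ∧ ∃ (χ : U →ₐ[k] k) (x y : U), E.HasForm χ 1 1 x y ∧ (∀ u : g, χ (ιU u) = 0) ∧
    x ∈ ĝ ∧ y ∈ ĝ ∧ x ≠ 0 ∧ y ≠ 0 ∧ ∀ u : g, E.δ (ιU u) ∈ ĝ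

/-- Family (c): `[a,b] = a`, `U(g)(0, 1, 1, x, y, δ)` with `x, y ∈ ĝ` nonzero, `α₀ y = β₀ x`,
`α' y = β' x`, `δ(a) = [δ(a), b] + [a, δ(b)]`, and one of the conditions (i), (ii). -/
def FamilyC (a b : g) (E : GeneralizedHopfOreExtension.{u, max u v, w} k U) : Prop :=
  ⁅a, b⁆ = a ∧ ∃ (χ : U →ₐ[k] k) (α α' β β' : ℕ →₀ k) (x y : U),
    x = combination a b α α' ∧ y = combination a b β β' ∧
    E.HasForm χ 1 1 x y ∧ (∀ u : g, χ (ιU u) = 0) ∧ x ≠ 0 ∧ y ≠ 0 ∧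
    α 0 • y = β 0 • x ∧ coeffSum α' • y = coeffSum β' • x ∧
    E.δ (ιU a) =
      (E.δ (ιU a) * ιU b - ιU b * E.δ (ιU a)) + (ιU a * E.δ (ιU b) - E.δ (ιU b) * ιU a) ∧
    ((x = α 0 • (ιU a : U) ∧ y = β 0 • (ιU a : U) ∧ ∀ u : g, E.δ (ιU u) ∈ ĝ) ∨
      (x ≠ α 0 • (ιU a : U) ∧
        E.δ (ιU a) - coeffSum β' • ((ιU a : U) * x) ∈ ĝ ∧
        E.δ (ιU b) - β 0 • ((ιU a : U) * x) ∈ ĝ))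

/-- Family (d): `[a,b] = a`, `U(g)(χ, 1, 1, x, y, δ)` with `χ(a) = 0`, `χ(b) = 1`, `x, y ∈ ĝ`
nonzero, `δ(g) ⊆ ĝ`, `[δ(a), b] + [a, δ(b)] = 0`, and one of the conditions (i), (ii). -/
def FamilyD (a b : g) (E : GeneralizedHopfOreExtension.{u, max u v, w} k U) : Prop :=
  ⁅a, b⁆ = a ∧ ∃ (χ : U →ₐ[k] k) (α α' β β' : ℕ →₀ k) (x y : U),
    x = combination a b α α' ∧ y = combination a b β β' ∧
    E.HasForm χ 1 1 x y ∧ χ (ιU a) = 0 ∧ χ (ιU b) = 1 ∧ x ≠ 0 ∧ y ≠ 0 ∧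
    (∀ u : g, E.δ (ιU u) ∈ ĝ) ∧
    (E.δ (ιU a) * ιU b - ιU b * E.δ (ιU a)) + (ιU a * E.δ (ιU b) - E.δ (ιU b) * ιU a) = 0 ∧
    ((x = α 0 • (ιU a : U) ∧ β 0 = 0 ∧ coeffSum β' = 0) ∨
      (α 0 = 0 ∧ coeffSum α' = 0 ∧ y = β 0 • (ιU a : U)))

/-- The condition `δ(g) ⊆ g`. -/
def PreservesLie (E : GeneralizedHopfOreExtension.{u, max u v, w} k U) : Prop := ∀ u : g, ∃ v : g, E.δ (ιU u) = ιU v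

/-- `E` is, as a Hopf algebra, the enveloping algebra of the Lie algebra `L`, by an isomorphism that
restricts on `g` to the Lie algebra map `j : g → L`. -/
def IsEnvelopingOf (E : GeneralizedHopfOreExtension.{u, max u v, w} k U) {L : Type t} [LieRing L] [LieAlgebra k L] (j : g →ₗ⁅k⁆ L) : Prop :=
  ∃ Ψ : E.carrier ≃ₐc[k] UniversalEnvelopingAlgebra k L,
    ∀ u : g, Ψ (E.incl (ιU u)) = UniversalEnvelopingAlgebra.ι k (j u)

end HopfOreChar2

end

/-! Everything is read off from the coefficients of the ordered monomials `a^i b^j`. They form a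
basis of `U(g)`, and the coefficient of a tensor of two monomials with exponents `p`, `q` in `Δ(w)`
is a product of binomial coefficients times the coefficient of `w` at `p + q`, whatever the bracket
is (`coeff₂_comul`). In characteristic 2 this has three consequences. Central binomial coefficients
are even, so `1` is the only group-like element. If `n` is not a power of 2, some `n.choose s` with
`0 < s < n` is odd, so primitive elements are combinations of the `a^(2^i)` and `b^(2^i)`. If `Δ(d)
= d ⊗ 1 + 1 ⊗ d + t`, then at nonzero exponents the coefficients of `t` are symmetric and vanish on
the diagonal.

For an extension with variable `z`, coassociativity at `z`, compared at the coefficients of `1` and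
`z`, makes `r₁` and `r₂` group-like, hence `1`, and leaves one equation for `x ⊗ y`. Since
group-likes are trivial, either a change of variable `z ↦ z + c` removes `x ⊗ y`, which gives family
(a), or `x` and `y` are nonzero and primitive (`coboundary_or_primitive_of_coassoc`).

In the second case, comultiplying `z u = τ(u) z + δ(u)` for `u` in `g` gives `τ(u) = u + χ(u)` and
shows that `δ(u)` fails to be primitive by `[x,u] ⊗ y + x ⊗ [y,u] - χ(u) x ⊗ y` (`comul_δ`). If `g`
is abelian, only the last term remains: either `χ = 0` on `g`, family (b), or `x ⊗ y` is a
coboundary after all, family (a). If `[a,b] = a`, then `[x,a] = α' a` and `[x,b] = α₀ a`, and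
likewise for `y`. Symmetry and zero diagonal of the resulting tensors are then linear algebra
(`smul_eq_smul_of_symm`, `eq_one_of_symm`): `χ(b) = 0` leads to family (c), while `χ(b) ≠ 0` forces
`χ(b) = 1` and family (d).

When `x = 0` and `δ(g) ⊆ g`, the relation reads `[z,u] = δ(u) + χ(u) z`, so `g + kz` is a Lie
algebra and the Ore presentation is that of its enveloping algebra. Conversely, an element `ζ` of
`L` outside `g` defines `δ` and `χ` by the same formula, and the Jacobi identity provides the
compatibility they need. -/

noncomputable section

attribute [local instance 100] LieRing.ofAssociativeRing
attribute [-simp] UniversalEnvelopingAlgebra.ι_apply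

/-! ### The monomial basis of the enveloping algebra of a two-dimensional Lie algebra -/

namespace TwoDimEnveloping

variable {k : Type u} [Field k] {g : Type v} [LieRing g] [LieAlgebra k g]

local notation "U" => UniversalEnvelopingAlgebra k g
local notation "ιU" => UniversalEnvelopingAlgebra.ι k

/-- Multiplication by the first basis vector in monomial coordinates. -/
def shiftA (k : Type u) [Field k] : Module.End k (ℕ × ℕ →₀ k) :=
  Finsupp.linearCombination k fun p => Finsupp.single (p.1 + 1, p.2) 1

/-- Multiplication by the second basis vector in monomial coordinates, where `[a, b] = c a`. -/
def shiftB {k : Type u} [Field k] (c : k) : Module.End k (ℕ × ℕ →₀ k) :=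
  Finsupp.linearCombination k fun p =>
    Finsupp.single (p.1, p.2 + 1) 1 - Finsupp.single p (c * (p.1 : k))

theorem shiftA_single (p : ℕ × ℕ) (r : k) :
    shiftA k (Finsupp.single p r) = Finsupp.single (p.1 + 1, p.2) r := by
  simp [shiftA, Finsupp.linearCombination_single]

theorem shiftB_single (c : k) (p : ℕ × ℕ) (r : k) :
    shiftB c (Finsupp.single p r) =
      Finsupp.single (p.1, p.2 + 1) r - Finsupp.single p (r * (c * (p.1 : k))) := by
  rw [shiftB, Finsupp.linearCombination_single, smul_sub, Finsupp.smul_single, Finsupp.smul_single,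
    smul_eq_mul, smul_eq_mul, mul_one]

/-- The relation `ab = c a + ba` holds for the two operators; this is what makes them a
representation of `g`. -/
theorem shiftA_mul_shiftB (c : k) :
    shiftA k * shiftB c = c • shiftA k + shiftB c * shiftA k := by
  refine Finsupp.lhom_ext fun p r => ?_
  simp only [LinearMap.add_apply, Module.End.mul_apply, shiftB_single, shiftA_single, map_sub,
    LinearMap.smul_apply, Finsupp.smul_single]
  have : r * (c * ((p.1 + 1 : ℕ) : k)) = r * (c * (p.1 : k)) + c • r := by
    push_cast
    rw [smul_eq_mul]
    ring
  rw [this, Finsupp.single_add]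
  abel

theorem basis_expand (B : Module.Basis (Fin 2) k g) (u : g) :
    u = B.repr u 0 • B 0 + B.repr u 1 • B 1 := by
  conv_lhs => rw [← B.sum_repr u]
  rw [Fin.sum_univ_two]

theorem lie_eq {B : Module.Basis (Fin 2) k g} {c : k} (hB : ⁅B 0, B 1⁆ = c • B 0) (u v : g) :
    ⁅u, v⁆ = ((B.repr u 0 * B.repr v 1 - B.repr u 1 * B.repr v 0) * c) • B 0 := by
  have h' : ⁅B 1, B 0⁆ = -(c • B 0) := by rw [← lie_skew, hB]
  conv_lhs => rw [basis_expand B u, basis_expand B v]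
  simp only [add_lie, lie_add, smul_lie, lie_smul, lie_self, hB, h', smul_zero, zero_add, add_zero]
  module

/-- The action on monomial coordinates, as a Lie algebra map. -/
def repLie {B : Module.Basis (Fin 2) k g} {c : k} (hB : ⁅B 0, B 1⁆ = c • B 0) :
    g →ₗ⁅k⁆ Module.End k (ℕ × ℕ →₀ k) where
  toFun u := B.repr u 0 • shiftA k + B.repr u 1 • shiftB c
  map_add' u v := by
    simp only [map_add, Finsupp.add_apply]
    module
  map_smul' r u := by
    simp only [map_smul, Finsupp.smul_apply, RingHom.id_apply]
    module
  map_lie' {u v} := by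
    rw [lie_eq hB u v]
    simp only [map_smul, Finsupp.smul_apply, Module.Basis.repr_self,
      LieRing.of_associative_ring_bracket]
    have h0 : (Finsupp.single (0 : Fin 2) (1 : k)) 0 = 1 := by simp
    have h1 : (Finsupp.single (0 : Fin 2) (1 : k)) 1 = 0 := by simp
    rw [h0, h1]
    have h := shiftA_mul_shiftB c
    simp only [add_mul, mul_add, smul_mul_assoc, mul_smul_comm, h]
    module

/-- The action of the enveloping algebra on monomial coordinates. -/
def rep {B : Module.Basis (Fin 2) k g} {c : k} (hB : ⁅B 0, B 1⁆ = c • B 0) :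
    U →ₐ[k] Module.End k (ℕ × ℕ →₀ k) :=
  UniversalEnvelopingAlgebra.lift k (repLie hB)

theorem rep_ι {B : Module.Basis (Fin 2) k g} {c : k} (hB : ⁅B 0, B 1⁆ = c • B 0) (u : g) :
    rep hB (ιU u) = B.repr u 0 • shiftA k + B.repr u 1 • shiftB c :=
  UniversalEnvelopingAlgebra.lift_ι_apply _ _ _

/-- The monomial `a ^ i * b ^ j`. -/
def monomial (B : Module.Basis (Fin 2) k g) (p : ℕ × ℕ) : U :=
  (ιU (B 0) : U) ^ p.1 * (ιU (B 1) : U) ^ p.2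

/-- The element of `U(g)` with the given monomial coordinates. -/
def ofCoords (B : Module.Basis (Fin 2) k g) : (ℕ × ℕ →₀ k) →ₗ[k] U :=
  Finsupp.linearCombination k (monomial B)

theorem ofCoords_single (B : Module.Basis (Fin 2) k g) (p : ℕ × ℕ) (r : k) :
    ofCoords B (Finsupp.single p r) = r • monomial B p := by
  simp [ofCoords, Finsupp.linearCombination_single]

/-- The coefficient of a monomial in an element of `U(g)`. -/
def coeff {B : Module.Basis (Fin 2) k g} {c : k} (hB : ⁅B 0, B 1⁆ = c • B 0) (p : ℕ × ℕ) :
    U →ₗ[k] k :=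
  Finsupp.lapply p ∘ₗ LinearMap.applyₗ (Finsupp.single (0, 0) (1 : k)) ∘ₗ (rep hB).toLinearMap

section

variable {B : Module.Basis (Fin 2) k g} {c : k} (hB : ⁅B 0, B 1⁆ = c • B 0)

include hB in
theorem ι_mul_sub : (ιU (B 0) : U) * ιU (B 1) - ιU (B 1) * ιU (B 0) = c • ιU (B 0) := by
  rw [← map_smul, ← hB, LieHom.map_lie, LieRing.of_associative_ring_bracket]

include hB in
theorem ι_one_mul_pow (i : ℕ) : (ιU (B 1) : U) * ιU (B 0) ^ i =
    ιU (B 0) ^ i * ιU (B 1) - (c * (i : k)) • (ιU (B 0) : U) ^ i := by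
  induction i with
  | zero => simp
  | succ i ih =>
    have h : (ιU (B 1) : U) * ιU (B 0) = ιU (B 0) * ιU (B 1) - c • ιU (B 0) := by
      rw [← ι_mul_sub hB]; abel
    rw [pow_succ, ← mul_assoc, ih, sub_mul, mul_assoc, h, mul_sub, mul_assoc, smul_mul_assoc,
      mul_smul_comm, ← pow_succ]
    push_cast
    module

theorem ofCoords_shiftA (m : ℕ × ℕ →₀ k) :
    ofCoords B (shiftA k m) = (ιU (B 0) : U) * ofCoords B m := by
  induction m using Finsupp.induction_linear with
  | zero => simp
  | add p q hp hq => rw [map_add, map_add, map_add, hp, hq, mul_add]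
  | single p r =>
    rw [shiftA_single, ofCoords_single, ofCoords_single, mul_smul_comm, monomial, monomial,
      ← mul_assoc, pow_succ']

include hB in
theorem ofCoords_shiftB (m : ℕ × ℕ →₀ k) :
    ofCoords B (shiftB c m) = (ιU (B 1) : U) * ofCoords B m := by
  induction m using Finsupp.induction_linear with
  | zero => simp
  | add p q hp hq => rw [map_add, map_add, map_add, hp, hq, mul_add]
  | single p r =>
    rw [shiftB_single, map_sub, ofCoords_single, ofCoords_single, ofCoords_single, mul_smul_comm,
      monomial, monomial, ← mul_assoc (ιU (B 1) : U), ι_one_mul_pow hB, sub_mul, mul_assoc,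
      ← pow_succ', smul_mul_assoc]
    module

/-- Equivariance is checked on generators. Applied to the vector of the monomial `1`, it shows that
every `w` is recovered from its coordinates, so the monomials span. -/
theorem ofCoords_rep (w : U) (m : ℕ × ℕ →₀ k) :
    ofCoords B (rep hB w m) = w * ofCoords B m := by
  let S : Subalgebra k U :=
    { carrier := {w | ∀ m, ofCoords B (rep hB w m) = w * ofCoords B m}
      mul_mem' := by
        intro p q hp hq m
        simp only [Set.mem_ofPred_eq] at hp hq
        rw [map_mul, Module.End.mul_apply, hp, hq, mul_assoc]
      add_mem' := by
        intro p q hp hq m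
        simp only [Set.mem_ofPred_eq] at hp hq
        rw [map_add, LinearMap.add_apply, map_add, hp, hq, add_mul]
      algebraMap_mem' := by
        intro r m
        rw [AlgHom.commutes, Module.algebraMap_end_apply, map_smul, Algebra.smul_def] }
  refine UEAHopf.mem_of_forall_ι S (fun u m => ?_) w m
  rw [rep_ι, LinearMap.add_apply, LinearMap.smul_apply, LinearMap.smul_apply, map_add, map_smul,
    map_smul, ofCoords_shiftA, ofCoords_shiftB hB]
  conv_rhs => rw [basis_expand B u]
  simp only [map_add, map_smul, add_mul, smul_mul_assoc]

theorem ofCoords_rep_one (w : U) : ofCoords B (rep hB w (Finsupp.single (0, 0) 1)) = w := by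
  rw [ofCoords_rep, ofCoords_single, monomial]
  simp

/-- Linear independence of the monomials: acting on the vector of `1`, they produce distinct basis
vectors. No correction term appears, because `b` acts before `a`, on vectors with first exponent
`0`. -/
theorem rep_monomial (p : ℕ × ℕ) :
    rep hB (monomial B p) (Finsupp.single (0, 0) 1) = Finsupp.single p 1 := by
  have hb : ∀ j : ℕ, (shiftB c ^ j) (Finsupp.single (0, 0) 1) = Finsupp.single (0, j) 1 := by
    intro j
    induction j with
    | zero => simp
    | succ j ih => rw [pow_succ', Module.End.mul_apply, ih, shiftB_single]; simp
  have ha : ∀ i j : ℕ, (shiftA k ^ i) (Finsupp.single (0, j) 1) = Finsupp.single (i, j) 1 := by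
    intro i j
    induction i with
    | zero => simp
    | succ i ih => rw [pow_succ', Module.End.mul_apply, ih, shiftA_single]
  have h0 : rep hB (ιU (B 0)) = shiftA k := by rw [rep_ι]; simp
  have h1 : rep hB (ιU (B 1)) = shiftB c := by rw [rep_ι]; simp
  rw [monomial, map_mul, map_pow, map_pow, h0, h1, Module.End.mul_apply, hb, ha]

theorem coeff_monomial (p q : ℕ × ℕ) : coeff hB p (monomial B q) = if q = p then 1 else 0 := by
  change (rep hB (monomial B q) (Finsupp.single (0, 0) 1)) p = _
  rw [rep_monomial, Finsupp.single_apply]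

/-- The coordinates of an element of `U(g)` with respect to the monomials. -/
def coords : U →ₗ[k] (ℕ × ℕ →₀ k) :=
  LinearMap.applyₗ (Finsupp.single (0, 0) (1 : k)) ∘ₗ (rep hB).toLinearMap

theorem ofCoords_coords (w : U) : ofCoords B (coords hB w) = w := ofCoords_rep_one hB w

theorem ext_coeff {w w' : U} (h : ∀ p, coeff hB p w = coeff hB p w') : w = w' := by
  rw [← ofCoords_coords hB w, ← ofCoords_coords hB w']
  congr 1
  ext p
  exact h p

include hB in
theorem linearMap_ext {M : Type*} [AddCommGroup M] [Module k M] {F G : U →ₗ[k] M}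
    (h : ∀ p, F (monomial B p) = G (monomial B p)) : F = G := by
  ext w
  rw [← ofCoords_coords hB w]
  change (F ∘ₗ ofCoords B) _ = (G ∘ₗ ofCoords B) _
  congr 1
  refine Finsupp.lhom_ext fun p r => ?_
  rw [LinearMap.comp_apply, LinearMap.comp_apply, ofCoords_single, map_smul, map_smul, h]

theorem coeff_one (p : ℕ × ℕ) : coeff hB p 1 = if (0, 0) = p then 1 else 0 := by
  rw [← coeff_monomial hB, monomial]
  simp

theorem coeff_ι_zero (p : ℕ × ℕ) : coeff hB p (ιU (B 0)) = if (1, 0) = p then 1 else 0 := by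
  rw [← coeff_monomial hB, monomial]
  simp

theorem coeff_ι_one (p : ℕ × ℕ) : coeff hB p (ιU (B 1)) = if (0, 1) = p then 1 else 0 := by
  rw [← coeff_monomial hB, monomial]
  simp

/-! ### The coproduct in monomial coordinates -/

/-- The coefficient of a tensor product of two monomials. -/
def coeff₂ (p q : ℕ × ℕ) : U ⊗[k] U →ₗ[k] k :=
  LinearMap.mul' k k ∘ₗ TensorProduct.map (coeff hB p) (coeff hB q)

@[simp]
theorem coeff₂_tmul (p q : ℕ × ℕ) (s t : U) :
    coeff₂ hB p q (s ⊗ₜ t) = coeff hB p s * coeff hB q t := by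
  simp [coeff₂]

/-- The binomial theorem for the commuting elements `u ⊗ 1` and `1 ⊗ u`. All powers of `a` stay to
the left of those of `b` in each leg, so the bracket does not enter. -/
theorem comul_monomial (p : ℕ × ℕ) : Coalgebra.comul (R := k) (monomial B p) =
    ∑ m ∈ Finset.HasAntidiagonal.antidiagonal p.1, ∑ n ∈ Finset.HasAntidiagonal.antidiagonal p.2,
      ((p.1.choose m.1 * p.2.choose n.1 : ℕ) : k) •
        (monomial B (m.1, n.1) ⊗ₜ[k] monomial B (m.2, n.2)) := by
  have hc : ∀ u : g, Commute ((ιU u : U) ⊗ₜ[k] (1 : U)) ((1 : U) ⊗ₜ[k] (ιU u : U)) := by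
    intro u
    simp [commute_iff_eq]
  rw [UEAHopf.comul_eq, monomial, map_mul, map_pow, map_pow, UEAHopf.comulHom_ι,
    UEAHopf.comulHom_ι, (hc _).add_pow', (hc _).add_pow', Finset.sum_mul_sum]
  refine Finset.sum_congr rfl fun m _ => Finset.sum_congr rfl fun n _ => ?_
  rw [smul_mul_smul_comm, Nat.cast_smul_eq_nsmul]
  simp only [Algebra.TensorProduct.tmul_pow, one_pow, Algebra.TensorProduct.tmul_mul_tmul, mul_one,
    one_mul, monomial]

theorem coeff₂_comul (p q : ℕ × ℕ) (w : U) : coeff₂ hB p q (Coalgebra.comul (R := k) w) =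
    ((p.1 + q.1).choose p.1 * (p.2 + q.2).choose p.2 : ℕ) * coeff hB (p + q) w := by
  suffices h : coeff₂ hB p q ∘ₗ Coalgebra.comul (R := k) =
      (((p.1 + q.1).choose p.1 * (p.2 + q.2).choose p.2 : ℕ) : k) • coeff hB (p + q) by
    simpa using DFunLike.congr_fun h w
  refine linearMap_ext hB fun r => ?_
  obtain ⟨p1, p2⟩ := p
  obtain ⟨q1, q2⟩ := q
  obtain ⟨r1, r2⟩ := r
  simp only [LinearMap.comp_apply, comul_monomial, map_sum, map_smul, coeff₂_tmul, coeff_monomial,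
    LinearMap.smul_apply, Prod.mk_add_mk, Prod.mk.injEq, smul_eq_mul]
  by_cases h : r1 = p1 + q1 ∧ r2 = p2 + q2
  · obtain ⟨rfl, rfl⟩ := h
    rw [Finset.sum_eq_single (p1, q1), Finset.sum_eq_single (p2, q2)]
    · simp
    · rintro ⟨n1, n2⟩ _ hn
      simp only [ne_eq, Prod.mk.injEq] at hn
      by_cases h1 : n1 = p2 <;> simp_all
    · simp
    · rintro ⟨m1, m2⟩ _ hm
      refine Finset.sum_eq_zero fun n _ => ?_
      simp only [ne_eq, Prod.mk.injEq] at hm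
      by_cases h1 : m1 = p1 <;> simp_all
    · simp
  -- If the exponents do not add up, no term of the double sum has both legs equal to the prescribed
  -- monomials.
  · rw [if_neg h, mul_zero]
    refine Finset.sum_eq_zero fun m hm => Finset.sum_eq_zero fun n hn => ?_
    rw [Finset.HasAntidiagonal.mem_antidiagonal] at hm hn
    by_cases h1 : m.1 = p1 ∧ n.1 = p2
    · have h2 : ¬ (m.2 = q1 ∧ n.2 = q2) := by
        rintro ⟨h2, h3⟩
        exact h ⟨by omega, by omega⟩
      simp [h2]
    · simp [h1]

end

end TwoDimEnveloping

end

noncomputable section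

attribute [local instance 100] LieRing.ofAssociativeRing
attribute [-simp] UniversalEnvelopingAlgebra.ι_apply

/-! ### Group-like and primitive elements in characteristic two -/

namespace TwoDimEnveloping

/-- For odd `n > 1` take `s = 1`. For even `n`, Lucas' theorem reduces to `n / 2`, which is again
not a power of 2. -/
theorem exists_odd_choose {n : ℕ} (h0 : n ≠ 0) (h : ∀ r, n ≠ 2 ^ r) :
    ∃ s t, s ≠ 0 ∧ t ≠ 0 ∧ s + t = n ∧ ¬ 2 ∣ n.choose s := by
  induction n using Nat.strong_induction_on with
  | _ n ih =>
    obtain ⟨m, rfl | rfl⟩ := n.even_or_odd'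
    · obtain ⟨s, t, hs, ht, rfl, hd⟩ := ih m (by omega) (by omega) fun r hr =>
        h (r + 1) (by rw [hr, pow_succ'])
      refine ⟨2 * s, 2 * t, by omega, by omega, by omega, fun hd' => hd ?_⟩
      have : Fact (Nat.Prime 2) := ⟨Nat.prime_two⟩
      have hl := Choose.choose_modEq_choose_mod_mul_choose_div_nat (n := 2 * (s + t)) (k := 2 * s)
        (p := 2)
      rw [Nat.mul_mod_right, Nat.mul_mod_right, Nat.choose_self, one_mul,
        Nat.mul_div_cancel_left _ two_pos, Nat.mul_div_cancel_left _ two_pos] at hl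
      exact (hl.dvd_iff (dvd_refl 2)).mp hd'
    · have hm : m ≠ 0 := by
        rintro rfl
        exact h 0 (by simp)
      exact ⟨1, 2 * m, by omega, by omega, by omega, by rw [Nat.choose_one_right]; omega⟩

variable {k : Type u} [Field k] [CharP k 2]

theorem natCast_eq_zero_of_even {n : ℕ} (h : 2 ∣ n) : (n : k) = 0 :=
  (CharP.cast_eq_zero_iff k 2 n).mpr h

theorem natCast_ne_zero_of_odd {n : ℕ} (h : ¬ 2 ∣ n) : (n : k) ≠ 0 :=
  fun h' => h ((CharP.cast_eq_zero_iff k 2 n).mp h')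

variable (k) in
theorem add_self_eq_zero_of_char_two {M : Type*} [AddCommGroup M] [Module k M] (m : M) :
    m + m = 0 := by
  have h : (2 : k) = 0 := by exact_mod_cast CharP.cast_eq_zero k 2
  rw [← two_smul k m, h, zero_smul]

variable (k) in
theorem neg_eq_of_char_two {M : Type*} [AddCommGroup M] [Module k M] (m : M) : -m = m :=
  neg_eq_of_add_eq_zero_left (add_self_eq_zero_of_char_two k m)

/-- At least one factor is the central binomial coefficient of a positive number, which is even. -/
theorem choose_mul_choose_self_eq_zero {p : ℕ × ℕ} (hp : p ≠ 0) :
    (((p.1 + p.1).choose p.1 * (p.2 + p.2).choose p.2 : ℕ) : k) = 0 := by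
  have hc : ∀ n : ℕ, n ≠ 0 → 2 ∣ (n + n).choose n := fun n hn => by
    rw [← two_mul]
    exact Nat.two_dvd_centralBinom_of_one_le (Nat.one_le_iff_ne_zero.mpr hn)
  apply natCast_eq_zero_of_even
  by_cases h1 : p.1 = 0
  · exact Dvd.dvd.mul_left (hc _ fun h2 => hp (Prod.ext h1 h2)) _
  · exact Dvd.dvd.mul_right (hc _ h1) _

variable {g : Type v} [LieRing g] [LieAlgebra k g]

local notation "U" => UniversalEnvelopingAlgebra k g
local notation "ιU" => UniversalEnvelopingAlgebra.ι k

section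

variable {B : Module.Basis (Fin 2) k g} {c : k} (hB : ⁅B 0, B 1⁆ = c • B 0)

-- In `w ⊗ w` the diagonal coefficient at `p` is the square of the coefficient of `w`; in `Δ(w)` it
-- is a multiple of a central binomial coefficient, hence zero for `p ≠ 0`. So `w` is a scalar, and
-- its counit is `1`.
include hB in
theorem eq_one_of_isGroupLikeElem {w : U} (hw : IsGroupLikeElem k w) : w = 1 := by
  have h : ∀ p : ℕ × ℕ, p ≠ 0 → coeff hB p w = 0 := by
    intro p hp
    have h := coeff₂_comul hB p p w
    rw [hw.comul_eq_tmul_self, coeff₂_tmul, choose_mul_choose_self_eq_zero hp, zero_mul] at h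
    exact mul_self_eq_zero.mp h
  have h1 : w = algebraMap k U (coeff hB 0 w) := by
    refine ext_coeff hB fun p => ?_
    rw [Algebra.algebraMap_eq_smul_one, map_smul, coeff_one]
    by_cases hp : p = 0
    · subst hp
      simp [Prod.zero_eq_mk]
    · rw [h p hp, if_neg (by rintro rfl; exact hp rfl), smul_zero]
  have h2 : coeff hB 0 w = 1 := by
    have := hw.counit_eq_one
    rwa [h1, Bialgebra.counit_algebraMap] at this
  rw [h1, h2, map_one]

omit [CharP k 2] in
/-- A failure of primitivity `t` of `d` has coefficients given by those of `d`. -/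
theorem coeff₂_of_comul_eq {d : U} {t : U ⊗[k] U}
    (h : Coalgebra.comul (R := k) d = d ⊗ₜ[k] (1 : U) + (1 : U) ⊗ₜ[k] d + t) {p q : ℕ × ℕ}
    (hp : p ≠ 0) (hq : q ≠ 0) : coeff₂ hB p q t =
      ((p.1 + q.1).choose p.1 * (p.2 + q.2).choose p.2 : ℕ) * coeff hB (p + q) d := by
  have h' := coeff₂_comul hB p q d
  have h1 : coeff hB p 1 = 0 := by rw [coeff_one, if_neg]; exact fun h => hp h.symm
  have h2 : coeff hB q 1 = 0 := by rw [coeff_one, if_neg]; exact fun h => hq h.symm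
  rw [h, map_add, map_add, coeff₂_tmul, coeff₂_tmul, h1, h2, mul_zero, zero_mul, zero_add,
    zero_add] at h'
  exact h'

-- Cocommutativity of `U(g)`, seen in coordinates as the symmetry of binomial coefficients.
omit [CharP k 2] in
theorem coeff₂_symm {d : U} {t : U ⊗[k] U}
    (h : Coalgebra.comul (R := k) d = d ⊗ₜ[k] (1 : U) + (1 : U) ⊗ₜ[k] d + t) {p q : ℕ × ℕ}
    (hp : p ≠ 0) (hq : q ≠ 0) : coeff₂ hB p q t = coeff₂ hB q p t := by
  rw [coeff₂_of_comul_eq hB h hp hq, coeff₂_of_comul_eq hB h hq hp, add_comm q p,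
    add_comm q.1, add_comm q.2, Nat.choose_symm_add, Nat.choose_symm_add]

theorem coeff₂_self_eq_zero {d : U} {t : U ⊗[k] U}
    (h : Coalgebra.comul (R := k) d = d ⊗ₜ[k] (1 : U) + (1 : U) ⊗ₜ[k] d + t) {p : ℕ × ℕ}
    (hp : p ≠ 0) : coeff₂ hB p p t = 0 := by
  rw [coeff₂_of_comul_eq hB h hp hp, choose_mul_choose_self_eq_zero hp, zero_mul]

/-- For such an exponent `p ≠ 0` there is a splitting `p = q + q'` into nonzero parts with odd
binomial factor, and the corresponding coefficient of `Δ(w)` is zero by primitivity. -/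
theorem coeff_eq_zero_of_primitive {w : U} (hw : IsSkewPrimitive k 1 1 w) {p : ℕ × ℕ}
    (h1 : ∀ r, p ≠ (2 ^ r, 0)) (h2 : ∀ r, p ≠ (0, 2 ^ r)) : coeff hB p w = 0 := by
  have hw' : Coalgebra.comul (R := k) w = w ⊗ₜ[k] (1 : U) + (1 : U) ⊗ₜ[k] w + 0 := by
    rw [add_zero]; exact hw
  have key : ∀ q q' : ℕ × ℕ, q ≠ 0 → q' ≠ 0 → q + q' = p →
      ¬ 2 ∣ p.1.choose q.1 * p.2.choose q.2 → coeff hB p w = 0 := by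
    rintro q q' hq hq' rfl h
    have := coeff₂_of_comul_eq hB hw' hq hq'
    rw [map_zero] at this
    exact (mul_eq_zero.mp this.symm).resolve_left (natCast_ne_zero_of_odd h)
  obtain ⟨i, j⟩ := p
  rcases eq_or_ne i 0 with rfl | hi
  · rcases eq_or_ne j 0 with rfl | hj
    -- The exponent `0` has no proper splitting; here primitivity reads `w₀ + w₀ = w₀` for the
    -- constant coefficient `w₀`.
    · have := coeff₂_comul hB 0 0 w
      rw [hw] at this
      have h0 : coeff hB 0 1 = 1 := by rw [coeff_one]; rfl
      have h : coeff hB 0 w = 0 := by simpa [h0] using this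
      exact h
    · obtain ⟨s, t, hs, ht, rfl, hd⟩ := exists_odd_choose hj fun r hr => h2 r (by rw [hr])
      exact key (0, s) (0, t) (by simpa) (by simpa) (by simp) (by simpa using hd)
  · rcases eq_or_ne j 0 with rfl | hj
    · obtain ⟨s, t, hs, ht, rfl, hd⟩ := exists_odd_choose hi fun r hr => h1 r (by rw [hr])
      exact key (s, 0) (t, 0) (by simpa) (by simpa) (by simp) (by simpa using hd)
    -- A mixed monomial splits into its two pure powers, with both binomials equal to `1`.
    · exact key (i, 0) (0, j) (by simpa) (by simpa) (by simp) (by simp)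

/-- The coefficients of the powers `a ^ (2 ^ i)`. -/
def coeffsA (w : U) : ℕ →₀ k :=
  (coords hB w).comapDomain (fun i => (2 ^ i, 0)) fun _ _ _ _ h =>
    Nat.pow_right_injective le_rfl (Prod.ext_iff.mp h).1

/-- The coefficients of the powers `b ^ (2 ^ i)`. -/
def coeffsB (w : U) : ℕ →₀ k :=
  (coords hB w).comapDomain (fun i => (0, 2 ^ i)) fun _ _ _ _ h =>
    Nat.pow_right_injective le_rfl (Prod.ext_iff.mp h).2

omit [CharP k 2] in
theorem coeffsA_apply (w : U) (i : ℕ) : coeffsA hB w i = coeff hB (2 ^ i, 0) w := rfl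

omit [CharP k 2] in
theorem coeffsB_apply (w : U) (i : ℕ) : coeffsB hB w i = coeff hB (0, 2 ^ i) w := rfl

omit [CharP k 2] in
theorem coeff_combination (α α' : ℕ →₀ k) (p : ℕ × ℕ) :
    coeff hB p (HopfOreChar2.combination (B 0) (B 1) α α') =
      (α.sum fun i r => if (2 ^ i, 0) = p then r else 0) +
        α'.sum fun i r => if (0, 2 ^ i) = p then r else 0 := by
  have ha : ∀ i : ℕ, (ιU (B 0) : U) ^ 2 ^ i = monomial B (2 ^ i, 0) := by simp [monomial]
  have hb : ∀ i : ℕ, (ιU (B 1) : U) ^ 2 ^ i = monomial B (0, 2 ^ i) := by simp [monomial]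
  simp [HopfOreChar2.combination, Finsupp.sum, map_sum, ha, hb, coeff_monomial]

theorem eq_combination_of_primitive {w : U} (hw : IsSkewPrimitive k 1 1 w) :
    w = HopfOreChar2.combination (B 0) (B 1) (coeffsA hB w) (coeffsB hB w) := by
  refine ext_coeff hB fun p => ?_
  rw [coeff_combination]
  have h2 : ∀ i : ℕ, (2 : ℕ) ^ i ≠ 0 := fun i => by positivity
  by_cases h1 : ∃ r, p = (2 ^ r, 0)
  · obtain ⟨r, rfl⟩ := h1
    simp only [Prod.mk.injEq, Nat.pow_right_inj one_lt_two, and_true, (h2 _).symm, false_and,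
       if_false, Finsupp.sum_fun_zero, add_zero]
    rw [Finsupp.sum_ite_self_eq']
    rfl
  · by_cases h3 : ∃ r, p = (0, 2 ^ r)
    · obtain ⟨r, rfl⟩ := h3
      simp only [Prod.mk.injEq, Nat.pow_right_inj one_lt_two, true_and, (h2 _).symm, h2, false_and,
        if_false, Finsupp.sum_fun_zero, zero_add]
      rw [Finsupp.sum_ite_self_eq']
      rfl
    · push Not at h1 h3
      rw [coeff_eq_zero_of_primitive hB hw h1 h3]
      simp [fun i => (h1 i).symm, fun i => (h3 i).symm]

include hB in
theorem mem_restrictedHull_of_primitive {w : U} (hw : IsSkewPrimitive k 1 1 w) :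
    w ∈ restrictedHull k g 2 := by
  rw [eq_combination_of_primitive hB hw, HopfOreChar2.combination]
  refine add_mem ?_ ?_ <;>
  exact sum_mem fun i _ => Submodule.smul_mem _ _ (Submodule.subset_span ⟨_, i, rfl⟩)

end

/-! ### Commutators -/

omit [CharP k 2] in
theorem commute_ι_of_abelian {B : Module.Basis (Fin 2) k g} (hB : ⁅B 0, B 1⁆ = 0) (w : U) (u : g) :
    w * ιU u = ιU u * w := by
  have h := UEAHopf.mem_of_forall_ι (Subalgebra.centralizer k {(ιU u : U)}) (fun v => ?_) w
  · exact (Subalgebra.mem_centralizer_iff k).mp h _ rfl |>.symm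
  · rw [Subalgebra.mem_centralizer_iff]
    rintro _ rfl
    rw [← sub_eq_zero, ← LieRing.of_associative_ring_bracket, ← LieHom.map_lie,
      lie_eq (B := B) (c := (0 : k)) (by rw [hB, zero_smul]), mul_zero, zero_smul, map_zero]

section

variable {B : Module.Basis (Fin 2) k g} (hB : ⁅B 0, B 1⁆ = B 0)

-- In characteristic 2, `ad (b^(2^i)) = (ad b)^(2^i)`, and `ad b` fixes `a` because `[b,a] = -a =
-- a`. The induction squares the relation, and the cross terms cancel in pairs.
include hB in
theorem pow_two_pow_mul_ι (i : ℕ) : (ιU (B 1) : U) ^ 2 ^ i * ιU (B 0) =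
    ιU (B 0) * ιU (B 1) ^ 2 ^ i + ιU (B 0) := by
  induction i with
  | zero =>
    have h := ι_mul_sub (B := B) (c := 1) (by rw [hB, one_smul])
    rw [one_smul, sub_eq_iff_eq_add] at h
    rw [pow_zero, pow_one, h, add_right_comm, add_self_eq_zero_of_char_two k, zero_add]
  | succ i ih =>
    rw [pow_succ, pow_mul, sq, mul_assoc, ih, mul_add, ← mul_assoc, ih, add_mul, mul_assoc,
      add_assoc, ← add_assoc _ _ (ιU (B 0) : U), add_self_eq_zero_of_char_two k, zero_add]

-- The powers of `a` commute with `a`, and each `b^(2^i)` contributes the same bracket `a`; hence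
-- only the sum of the `b`-coefficients survives.
include hB in
theorem combination_lie_zero (α α' : ℕ →₀ k) :
    HopfOreChar2.combination (B 0) (B 1) α α' * ιU (B 0) -
      ιU (B 0) * HopfOreChar2.combination (B 0) (B 1) α α' =
        HopfOreChar2.coeffSum α' • (ιU (B 0) : U) := by
  simp only [HopfOreChar2.combination, HopfOreChar2.coeffSum, Finsupp.sum, add_mul, mul_add,
    Finset.sum_mul, Finset.mul_sum, smul_mul_assoc, mul_smul_comm, pow_two_pow_mul_ι hB,
    ← pow_succ, ← pow_succ', smul_add, Finset.sum_add_distrib, Finset.sum_smul]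
  abel

-- Since `[a^n, b] = n a^n`, the powers `a^(2^i)` with `i > 0` commute with `b`, and only the linear
-- term in `a` survives.
include hB in
theorem combination_lie_one (α α' : ℕ →₀ k) :
    HopfOreChar2.combination (B 0) (B 1) α α' * ιU (B 1) -
      ιU (B 1) * HopfOreChar2.combination (B 0) (B 1) α α' = α 0 • (ιU (B 0) : U) := by
  have h : ∀ n : ℕ, (ιU (B 1) : U) * ιU (B 0) ^ n =
      ιU (B 0) ^ n * ιU (B 1) - (1 * (n : k)) • (ιU (B 0) : U) ^ n :=
    ι_one_mul_pow (by rw [hB, one_smul])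
  have h2 : ∀ i : ℕ, ((2 ^ i : ℕ) : k) = if i = 0 then 1 else 0 := by
    intro i
    split_ifs with hi
    · simp [hi]
    · exact natCast_eq_zero_of_even (dvd_pow_self 2 hi)
  simp only [HopfOreChar2.combination, Finsupp.sum, add_mul, mul_add,
    Finset.sum_mul, Finset.mul_sum, smul_mul_assoc, mul_smul_comm, h,
    ← pow_succ, ← pow_succ', smul_sub, Finset.sum_sub_distrib, one_mul, h2]
  have h3 : ∑ i ∈ α.support, α i • (if i = 0 then (1 : k) else 0) • (ιU (B 0) : U) ^ 2 ^ i =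
      α 0 • (ιU (B 0) : U) := by
    rw [Finset.sum_eq_single 0]
    · simp
    · intro i _ hi
      simp [hi]
    · intro hi
      simp [Finsupp.notMem_support_iff.mp hi]
  rw [h3]
  abel

end

/-! ### Tensors of rank two with symmetric coefficients and zero diagonal -/

/-- Here `A` is the coordinate vector of `a`, supported at `e`. Symmetry of `s A ⊗ Y + t X ⊗ A` at
the pair `(e, p)` gives the equation for `p ≠ e`; at `e` it is the vanishing of the diagonal, where
the sign is irrelevant. -/
theorem smul_eq_smul_of_symm {ι : Type*} {N : Set ι} {X Y A : ι → k} {e : ι} (he : e ∈ N)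
    (hA1 : A e = 1) (hA : ∀ p, p ≠ e → A p = 0) {s t : k}
    (hsymm : ∀ p ∈ N, ∀ q ∈ N, s * (A p * Y q) + t * (X p * A q) =
      s * (A q * Y p) + t * (X q * A p))
    (hdiag : ∀ p ∈ N, s * (A p * Y p) + t * (X p * A p) = 0) {p : ι} (hp : p ∈ N) :
    s * Y p = t * X p := by
  by_cases h : p = e
  · subst h
    have := hdiag p hp
    rw [hA1, one_mul, mul_one] at this
    rwa [← sub_eq_zero, sub_eq_add_neg, neg_eq_of_char_two k]
  · have := hsymm e he p hp
    simpa [hA1, hA p h] using this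

/-- The zero diagonal makes `X` and `Y` disjointly supported (at `e` the first two terms cancel).
Symmetry away from `e` then forces one of them to be supported at `e` alone, and the row of `e`
gives `(1 + l) r = 0` for some `r ≠ 0`. -/
theorem eq_one_of_symm {ι : Type*} {N : Set ι} {X Y A : ι → k} {e : ι} (he : e ∈ N)
    (hA1 : A e = 1) (hA : ∀ p, p ≠ e → A p = 0) {l : k} (hl : l ≠ 0)
    (hsymm : ∀ p ∈ N, ∀ q ∈ N, X e * (A p * Y q) + Y e * (X p * A q) + l * (X p * Y q) =
      X e * (A q * Y p) + Y e * (X q * A p) + l * (X q * Y p))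
    (hdiag : ∀ p ∈ N, X e * (A p * Y p) + Y e * (X p * A p) + l * (X p * Y p) = 0)
    (hX : ∃ p ∈ N, X p ≠ 0) (hY : ∃ p ∈ N, Y p ≠ 0) :
    l = 1 ∧ ((Y e = 0 ∧ ∀ p ∈ N, p ≠ e → X p = 0) ∨ (X e = 0 ∧ ∀ p ∈ N, p ≠ e → Y p = 0)) := by
  have h0 : X e = 0 ∨ Y e = 0 := by
    have h := hdiag e he
    rw [hA1, one_mul, mul_one, mul_comm (Y e), add_self_eq_zero_of_char_two k, zero_add] at h
    simpa [hl] using h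
  have h1 : ∀ p ∈ N, p ≠ e → X p = 0 ∨ Y p = 0 := by
    intro p hp hpe
    have h := hdiag p hp
    simpa [hA p hpe, hl] using h
  have h2 : ∀ p ∈ N, p ≠ e → X e * Y p + l * (X e * Y p) = Y e * X p + l * (X p * Y e) := by
    intro p hp hpe
    have h := hsymm e he p hp
    simpa [hA1, hA p hpe] using h
  have h3 : ∀ p ∈ N, p ≠ e → ∀ q ∈ N, q ≠ e → X p * Y q = X q * Y p := by
    intro p hp hpe q hq hqe
    have h := hsymm p hp q hq
    simpa [hA p hpe, hA q hqe, hl] using h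
  have hone : ∀ r : k, r ≠ 0 → r + l * r = 0 → l = 1 := by
    intro r hr h
    have h : (1 + l) * r = 0 := by linear_combination h
    have h' := (mul_eq_zero.mp h).resolve_right hr
    rw [← neg_eq_of_char_two k l]
    exact neg_eq_of_add_eq_zero_left h'
  by_cases hx : ∃ p ∈ N, p ≠ e ∧ X p ≠ 0
  · obtain ⟨p, hp, hpe, hxp⟩ := hx
    have hyp : Y p = 0 := (h1 p hp hpe).resolve_left hxp
    have hy : ∀ q ∈ N, q ≠ e → Y q = 0 := by
      intro q hq hqe
      have h := h3 p hp hpe q hq hqe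
      rw [hyp, mul_zero] at h
      exact (mul_eq_zero.mp h).resolve_left hxp
    have hye : Y e ≠ 0 := by
      obtain ⟨q, hq, hyq⟩ := hY
      intro h
      by_cases hqe : q = e
      · exact hyq (hqe ▸ h)
      · exact hyq (hy q hq hqe)
    have hxe := h0.resolve_right hye
    have h := h2 p hp hpe
    rw [hxe, zero_mul, mul_zero, add_zero] at h
    refine ⟨hone (Y e * X p) (mul_ne_zero hye hxp) ?_, Or.inr ⟨hxe, hy⟩⟩
    rw [h]
    ring
  · have hx : ∀ p ∈ N, p ≠ e → X p = 0 := by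
      intro p hp hpe
      by_contra h
      exact hx ⟨p, hp, hpe, h⟩
    have hxe : X e ≠ 0 := by
      obtain ⟨q, hq, hxq⟩ := hX
      intro h
      by_cases hqe : q = e
      · exact hxq (hqe ▸ h)
      · exact hxq (hx q hq hqe)
    have hye := h0.resolve_left hxe
    obtain ⟨q, hq, hyq⟩ := hY
    have hqe : q ≠ e := by
      rintro rfl
      exact hyq hye
    have h := h2 q hq hqe
    rw [hye, zero_mul, mul_zero, mul_zero, add_zero] at h
    exact ⟨hone _ (mul_ne_zero hxe hyq) h, Or.inl ⟨hye, hx⟩⟩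

end TwoDimEnveloping

end

noncomputable section

/-! ### Ore extensions: universal property and low coefficients -/

namespace OreExtension

variable {k : Type u} {A : Type v} [CommRing k] [Ring A] [Algebra k A]
  {τ : A →ₐ[k] A} {δ : A →ₗ[k] A}

theorem z_mul_of (a : A) : z τ δ * of τ δ a = of τ δ (τ a) * z τ δ + of τ δ (δ a) := by
  have h := mk_rel τ δ (Rel.ore a)
  rwa [map_mul, map_add, map_mul] at h

/-- The universal property of an Ore extension. -/
def lift {H : Type w} [Ring H] [Algebra k H] (f : A →ₐ[k] H) (ζ : H)
    (h : ∀ a, ζ * f a = f (τ a) * ζ + f (δ a)) : OreExtension τ δ →ₐ[k] H :=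
  RingQuot.liftAlgHom k ⟨FreeAlgebra.lift k fun o => o.elim ζ f, by
    rintro _ _ (⟨a, b⟩ | ⟨a, b⟩ | ⟨c⟩ | ⟨a⟩)
    · simp
    · simp
    · simp
    · simp [h]⟩

section

variable {H : Type w} [Ring H] [Algebra k H]

@[simp]
theorem lift_of (f : A →ₐ[k] H) (ζ : H) (h : ∀ a, ζ * f a = f (τ a) * ζ + f (δ a)) (a : A) :
    lift f ζ h (of τ δ a) = f a := by
  change RingQuot.liftAlgHom k _ (RingQuot.mkAlgHom k _ _) = _
  rw [RingQuot.liftAlgHom_mkAlgHom_apply, FreeAlgebra.lift_ι_apply]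
  rfl

@[simp]
theorem lift_z (f : A →ₐ[k] H) (ζ : H) (h : ∀ a, ζ * f a = f (τ a) * ζ + f (δ a)) :
    lift f ζ h (z τ δ) = ζ := by
  change RingQuot.liftAlgHom k _ (RingQuot.mkAlgHom k _ _) = _
  rw [RingQuot.liftAlgHom_mkAlgHom_apply, FreeAlgebra.lift_ι_apply]
  rfl

theorem hom_ext {F G : OreExtension τ δ →ₐ[k] H} (h : ∀ a, F (of τ δ a) = G (of τ δ a))
    (hz : F (z τ δ) = G (z τ δ)) : F = G := by
  refine RingQuot.ringQuot_ext' k F G (FreeAlgebra.hom_ext ?_)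
  funext o
  cases o with
  | none => exact hz
  | some a => exact h a

end

/-- The derivation after the change of variable `z ↦ z + c`. -/
def translateδ (τ : A →ₐ[k] A) (δ : A →ₗ[k] A) (c : A) : A →ₗ[k] A :=
  δ + LinearMap.mulLeft k c - LinearMap.mulRight k c ∘ₗ τ.toLinearMap

theorem translateδ_apply (c a : A) : translateδ τ δ c a = δ a + c * a - τ a * c := rfl

/-- The change of variable `z ↦ z + c`. -/
def translate (τ : A →ₐ[k] A) (δ : A →ₗ[k] A) (c : A) :
    OreExtension τ (translateδ τ δ c) ≃ₐ[k] OreExtension τ δ :=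
  AlgEquiv.ofAlgHom
    (lift (of τ δ) (z τ δ + of τ δ c) fun a => by
      rw [translateδ_apply, map_sub, map_add, map_mul, map_mul, add_mul, z_mul_of, mul_add]
      abel)
    (lift (of τ _) (z τ _ - of τ _ c) fun a => by
      have h' : δ a = translateδ τ δ c a - c * a + τ a * c := by rw [translateδ_apply]; abel
      rw [h', map_add, map_sub, map_mul, map_mul, sub_mul, z_mul_of, mul_sub]
      abel)
    (hom_ext (fun a => by simp) (by simp))
    (hom_ext (fun a => by simp) (by simp))

@[simp]
theorem translate_of (c a : A) : translate τ δ c (of τ _ a) = of τ δ a :=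
  lift_of _ _ _ _

@[simp]
theorem translate_z (c : A) : translate τ δ c (z τ _) = z τ δ + of τ δ c :=
  lift_z _ _ _

/-- The action of the variable on the quotient of `A[z; τ, δ]` by the left ideal generated by
`z ^ 2`, in the coordinates given by `1` and `z`. -/
def truncZ (τ : A →ₐ[k] A) (δ : A →ₗ[k] A) : Module.End k (A × A) :=
  LinearMap.prod (δ ∘ₗ LinearMap.fst k A A)
    (τ.toLinearMap ∘ₗ LinearMap.fst k A A + δ ∘ₗ LinearMap.snd k A A)

/-- The action of `A[z; τ, δ]` on its quotient by the left ideal generated by `z ^ 2`. -/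
def truncRep (hδ : ∀ a b, δ (a * b) = τ a * δ b + δ a * b) :
    OreExtension τ δ →ₐ[k] Module.End k (A × A) :=
  lift (Algebra.lsmul k k (A × A)) (truncZ τ δ) fun a => by
    refine LinearMap.ext fun m => Prod.ext ?_ ?_
    · simp [truncZ, hδ]
    · simp [truncZ, hδ, mul_add, add_assoc]

/-- The coordinates of an element of `A[z; τ, δ]` at `1` and `z`. -/
def trunc (hδ : ∀ a b, δ (a * b) = τ a * δ b + δ a * b) : OreExtension τ δ →ₗ[k] A × A :=
  LinearMap.applyₗ ((1, 0) : A × A) ∘ₗ (truncRep hδ).toLinearMap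

/-- Together with `trunc_of_mul_z`, this makes `1` and `z` left independent over `A`. Later
comparisons use only these two coordinates, so a basis of all powers of `z` is not needed. -/
theorem trunc_of (hδ : ∀ a b, δ (a * b) = τ a * δ b + δ a * b) (a : A) :
    trunc hδ (of τ δ a) = (a, 0) := by
  simp [trunc, truncRep]

theorem trunc_of_mul_z (hδ : ∀ a b, δ (a * b) = τ a * δ b + δ a * b) (a : A) :
    trunc hδ (of τ δ a * z τ δ) = (0, a) := by
  have h1 : δ 1 = 0 := by simpa using hδ 1 1
  simp [trunc, truncRep, truncZ, h1]

end OreExtension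

/-! ### General facts on generalized Hopf-Ore extensions -/

namespace GeneralizedHopfOreExtension

variable {k : Type u} [Field k] {A : Type v} [Ring A] [HopfAlgebra k A]
  (E : GeneralizedHopfOreExtension.{u, v, w} k A)

/-- The variable of the extension. -/
def var : E.carrier := E.e (OreExtension.z E.τ E.δ)

/-- The constant coefficient. -/
def coeff₀ : E.carrier →ₗ[k] A :=
  LinearMap.fst k A A ∘ₗ OreExtension.trunc E.δ_mul ∘ₗ E.e.symm.toLinearMap

/-- The coefficient of the variable. -/
def coeff₁ : E.carrier →ₗ[k] A :=
  LinearMap.snd k A A ∘ₗ OreExtension.trunc E.δ_mul ∘ₗ E.e.symm.toLinearMap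

theorem incl_apply (a : A) : E.incl a = E.e (OreExtension.of E.τ E.δ a) := rfl

theorem var_mul_incl (a : A) : E.var * E.incl a = E.incl (E.τ a) * E.var + E.incl (E.δ a) := by
  simp only [var, incl_apply]
  rw [← map_mul, OreExtension.z_mul_of, map_add, map_mul]

@[simp] theorem coeff₀_incl (a : A) : E.coeff₀ (E.incl a) = a := by
  simp [coeff₀, incl_apply, OreExtension.trunc_of]

@[simp] theorem coeff₁_incl (a : A) : E.coeff₁ (E.incl a) = 0 := by
  simp [coeff₁, incl_apply, OreExtension.trunc_of]

@[simp] theorem coeff₀_incl_mul_var (a : A) : E.coeff₀ (E.incl a * E.var) = 0 := by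
  simp [coeff₀, incl_apply, var, ← map_mul, OreExtension.trunc_of_mul_z]

@[simp] theorem coeff₁_incl_mul_var (a : A) : E.coeff₁ (E.incl a * E.var) = a := by
  simp [coeff₁, incl_apply, var, ← map_mul, OreExtension.trunc_of_mul_z]

@[simp] theorem coeff₀_var : E.coeff₀ E.var = 0 := by
  simpa using E.coeff₀_incl_mul_var 1

@[simp] theorem coeff₁_var : E.coeff₁ E.var = 1 := by
  simpa using E.coeff₁_incl_mul_var 1

theorem coeff₀_comp_incl : E.coeff₀ ∘ₗ E.incl.toLinearMap = LinearMap.id :=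
  LinearMap.ext E.coeff₀_incl

theorem coeff₁_comp_incl : E.coeff₁ ∘ₗ E.incl.toLinearMap = 0 :=
  LinearMap.ext E.coeff₁_incl

theorem counit_incl (a : A) :
    Coalgebra.counit (R := k) (E.incl a) = Coalgebra.counit (R := k) a :=
  E.counit_of a

theorem comul_incl (a : A) : Coalgebra.comul (R := k) (E.incl a) =
    TensorProduct.map E.incl.toLinearMap E.incl.toLinearMap (Coalgebra.comul (R := k) a) :=
  E.comul_of a

theorem comul_var : Coalgebra.comul (R := k) E.var =
    E.var ⊗ₜ[k] E.incl E.r₁ + E.incl E.x ⊗ₜ[k] E.incl E.y + E.incl E.r₂ ⊗ₜ[k] E.var :=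
  E.comul_z

/-- Compare the coefficients of `z` in the counit axiom for `z`; a final counit turns the identity
in `A` into one of scalars. -/
theorem counit_r₁ : Coalgebra.counit (R := k) E.r₁ = 1 := by
  have h := Coalgebra.lTensor_counit_comul (R := k) E.var
  rw [comul_var, map_add, map_add, LinearMap.lTensor_tmul, LinearMap.lTensor_tmul,
    LinearMap.lTensor_tmul] at h
  have h' := congrArg (fun t => Coalgebra.counit (R := k)
    (E.coeff₁ (TensorProduct.rid k E.carrier t))) h
  simpa [counit_incl] using h'

theorem counit_r₂ : Coalgebra.counit (R := k) E.r₂ = 1 := by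
  have h := Coalgebra.rTensor_counit_comul (R := k) E.var
  rw [comul_var, map_add, map_add, LinearMap.rTensor_tmul, LinearMap.rTensor_tmul,
    LinearMap.rTensor_tmul] at h
  have h' := congrArg (fun t => Coalgebra.counit (R := k)
    (E.coeff₁ (TensorProduct.lid k E.carrier t))) h
  simpa [counit_incl] using h'

theorem map_assoc_incl (f₁ f₂ f₃ : E.carrier →ₗ[k] A) (s : A ⊗[k] A) (h : E.carrier) :
    TensorProduct.map f₁ (TensorProduct.map f₂ f₃) (TensorProduct.assoc k _ _ _
      (TensorProduct.map E.incl.toLinearMap E.incl.toLinearMap s ⊗ₜ[k] h)) =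
    TensorProduct.assoc k _ _ _ (TensorProduct.map (f₁ ∘ₗ E.incl.toLinearMap)
      (f₂ ∘ₗ E.incl.toLinearMap) s ⊗ₜ[k] f₃ h) := by
  induction s using TensorProduct.induction_on with
  | zero => simp
  | add p q hp hq => simp only [map_add, TensorProduct.add_tmul, hp, hq]
  | tmul p q => simp

theorem map_map_incl (f₁ f₂ : E.carrier →ₗ[k] A) (s : A ⊗[k] A) :
    TensorProduct.map f₁ f₂ (TensorProduct.map E.incl.toLinearMap E.incl.toLinearMap s) =
      TensorProduct.map (f₁ ∘ₗ E.incl.toLinearMap) (f₂ ∘ₗ E.incl.toLinearMap) s := by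
  rw [TensorProduct.map_comp]
  rfl

/-- The coassociativity law for the variable, after applying a linear map to each leg. -/
theorem coassoc_var (f₁ f₂ f₃ : E.carrier →ₗ[k] A) :
    f₁ E.var ⊗ₜ[k] (f₂ (E.incl E.r₁) ⊗ₜ[k] f₃ (E.incl E.r₁)) +
      f₁ (E.incl E.x) ⊗ₜ[k] (f₂ (E.incl E.y) ⊗ₜ[k] f₃ (E.incl E.r₁)) +
      f₁ (E.incl E.r₂) ⊗ₜ[k] (f₂ E.var ⊗ₜ[k] f₃ (E.incl E.r₁)) +
      TensorProduct.assoc k _ _ _ (TensorProduct.map (f₁ ∘ₗ E.incl.toLinearMap)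
        (f₂ ∘ₗ E.incl.toLinearMap) (Coalgebra.comul (R := k) E.x) ⊗ₜ[k] f₃ (E.incl E.y)) +
      TensorProduct.assoc k _ _ _ (TensorProduct.map (f₁ ∘ₗ E.incl.toLinearMap)
        (f₂ ∘ₗ E.incl.toLinearMap) (Coalgebra.comul (R := k) E.r₂) ⊗ₜ[k] f₃ E.var) =
    f₁ E.var ⊗ₜ[k] TensorProduct.map (f₂ ∘ₗ E.incl.toLinearMap) (f₃ ∘ₗ E.incl.toLinearMap)
        (Coalgebra.comul (R := k) E.r₁) +
      f₁ (E.incl E.x) ⊗ₜ[k] TensorProduct.map (f₂ ∘ₗ E.incl.toLinearMap)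
        (f₃ ∘ₗ E.incl.toLinearMap) (Coalgebra.comul (R := k) E.y) +
      (f₁ (E.incl E.r₂) ⊗ₜ[k] (f₂ E.var ⊗ₜ[k] f₃ (E.incl E.r₁)) +
        f₁ (E.incl E.r₂) ⊗ₜ[k] (f₂ (E.incl E.x) ⊗ₜ[k] f₃ (E.incl E.y)) +
        f₁ (E.incl E.r₂) ⊗ₜ[k] (f₂ (E.incl E.r₂) ⊗ₜ[k] f₃ E.var)) := by
  have h := congrArg (TensorProduct.map f₁ (TensorProduct.map f₂ f₃))
    (Coalgebra.coassoc_apply (R := k) E.var)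
  simpa only [comul_var, comul_incl, map_add, LinearMap.rTensor_tmul, LinearMap.lTensor_tmul,
    TensorProduct.add_tmul, TensorProduct.tmul_add, map_assoc_incl, TensorProduct.map_tmul,
    map_map_incl, TensorProduct.assoc_tmul, ← add_assoc] using h

/-- Take the part of coassociativity at `z` with `z` in the first leg and elements of `A` in the
others: it is `1 ⊗ r₁ ⊗ r₁ = 1 ⊗ Δ(r₁)`. For `r₂` the variable sits in the last leg. -/
theorem isGroupLikeElem_r₁ : IsGroupLikeElem k E.r₁ := by
  refine ⟨E.counit_r₁, ?_⟩
  have h := E.coassoc_var E.coeff₁ E.coeff₀ E.coeff₀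
  simp only [coeff₁_var, coeff₁_incl, coeff₀_incl, coeff₀_var, coeff₀_comp_incl, coeff₁_comp_incl,
    TensorProduct.zero_tmul, TensorProduct.tmul_zero, TensorProduct.map_zero_left, map_zero,
    LinearMap.zero_apply, TensorProduct.map_id, LinearMap.id_apply, add_zero] at h
  have h' := congrArg (fun s => TensorProduct.lid k _ (LinearMap.rTensor _
    (Coalgebra.counit (R := k) (A := A)) s)) h
  simpa using h'.symm

theorem isGroupLikeElem_r₂ : IsGroupLikeElem k E.r₂ := by
  refine ⟨E.counit_r₂, ?_⟩
  have h := E.coassoc_var E.coeff₀ E.coeff₀ E.coeff₁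
  simp only [coeff₁_var, coeff₁_incl, coeff₀_incl, coeff₀_var, coeff₀_comp_incl, coeff₁_comp_incl,
    TensorProduct.tmul_zero, TensorProduct.map_zero_right, map_zero,
    LinearMap.zero_apply, TensorProduct.map_id, LinearMap.id_apply, add_zero, zero_add,
    ← TensorProduct.assoc_tmul, (TensorProduct.assoc k A A A).injective.eq_iff] at h
  have h' := congrArg (fun s => TensorProduct.rid k _ (LinearMap.lTensor _
    (Coalgebra.counit (R := k) (A := A)) s)) h
  simpa using h'

/-- The condition on `(x, y)` given by coassociativity when `r₁ = r₂ = 1`. -/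
theorem coassoc_xy (h₁ : E.r₁ = 1) (h₂ : E.r₂ = 1) :
    E.x ⊗ₜ[k] (E.y ⊗ₜ[k] (1 : A)) +
      TensorProduct.assoc k _ _ _ (Coalgebra.comul (R := k) E.x ⊗ₜ[k] E.y) =
    E.x ⊗ₜ[k] Coalgebra.comul (R := k) E.y + (1 : A) ⊗ₜ[k] (E.x ⊗ₜ[k] E.y) := by
  have h := E.coassoc_var E.coeff₀ E.coeff₀ E.coeff₀
  simpa only [coeff₀_incl, coeff₀_var, coeff₀_comp_incl, h₁, h₂,
    TensorProduct.zero_tmul, TensorProduct.tmul_zero, map_zero,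
    TensorProduct.map_id, LinearMap.id_apply, add_zero, zero_add] using h

end GeneralizedHopfOreExtension

end

noncomputable section

attribute [local instance 100] LieRing.ofAssociativeRing
attribute [-simp] UniversalEnvelopingAlgebra.ι_apply

/-! ### Normalization -/

theorem exists_dual_eq_one {k : Type u} [Field k] {V : Type v} [AddCommGroup V] [Module k V]
    {x : V} (hx : x ≠ 0) : ∃ f : V →ₗ[k] k, f x = 1 := by
  obtain ⟨f, hf⟩ := not_forall.mp fun h => hx ((Module.forall_dual_apply_eq_zero_iff k x).mp h)
  exact ⟨(f x)⁻¹ • f, by simp [hf]⟩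

theorem tmul_left_cancel {k : Type u} [Field k] {V : Type v} [AddCommGroup V] [Module k V]
    {W : Type w} [AddCommGroup W] [Module k W] {x : V} (hx : x ≠ 0) {s s' : W}
    (h : x ⊗ₜ[k] s = x ⊗ₜ[k] s') : s = s' := by
  obtain ⟨f, hf⟩ := exists_dual_eq_one (k := k) hx
  simpa [hf] using congrArg (fun r => TensorProduct.lid k W (LinearMap.rTensor W f r)) h

section

variable {k : Type u} [Field k] {A : Type v} [Ring A] [HopfAlgebra k A]

theorem eq_algebraMap_of_comul_eq_tmul_one {y : A}
    (h : Coalgebra.comul (R := k) y = y ⊗ₜ[k] (1 : A)) :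
    y = algebraMap k A (Coalgebra.counit (R := k) y) := by
  have h' := Coalgebra.rTensor_counit_comul (R := k) y
  rw [h, LinearMap.rTensor_tmul] at h'
  have := congrArg (TensorProduct.lid k A) h'
  simpa [Algebra.algebraMap_eq_smul_one] using this.symm

theorem eq_algebraMap_of_comul_eq_one_tmul {y : A}
    (h : Coalgebra.comul (R := k) y = (1 : A) ⊗ₜ[k] y) :
    y = algebraMap k A (Coalgebra.counit (R := k) y) := by
  have h' := Coalgebra.lTensor_counit_comul (R := k) y
  rw [h, LinearMap.lTensor_tmul] at h'
  have := congrArg (TensorProduct.rid k A) h'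
  simpa [Algebra.algebraMap_eq_smul_one] using this.symm

/-- A functional `f` with `f(y) = 1`, applied to the third leg, isolates `Δ(x)`; the element `w` is
the image of `Δ(y) - y ⊗ 1` under `id ⊗ f`. -/
theorem exists_comul_eq_of_coassoc {x y : A} (hy : y ≠ 0)
    (h : x ⊗ₜ[k] (y ⊗ₜ[k] (1 : A)) +
      TensorProduct.assoc k _ _ _ (Coalgebra.comul (R := k) x ⊗ₜ[k] y) =
      x ⊗ₜ[k] Coalgebra.comul (R := k) y + (1 : A) ⊗ₜ[k] (x ⊗ₜ[k] y)) :
    ∃ w : A, Coalgebra.comul (R := k) x = (1 : A) ⊗ₜ[k] x + x ⊗ₜ[k] w := by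
  obtain ⟨f, hf⟩ := exists_dual_eq_one (k := k) hy
  let F : A ⊗[k] A →ₗ[k] A := (TensorProduct.rid k A).toLinearMap ∘ₗ LinearMap.lTensor A f
  have hF : ∀ s : A ⊗[k] A,
      LinearMap.lTensor A F (TensorProduct.assoc k _ _ _ (s ⊗ₜ[k] y)) = s := by
    intro s
    induction s using TensorProduct.induction_on with
    | zero => simp
    | add p q hp hq => simp only [map_add, TensorProduct.add_tmul, hp, hq]
    | tmul p q => simp [F, hf]
  have h' := congrArg (LinearMap.lTensor A F) h
  rw [map_add, map_add, hF, LinearMap.lTensor_tmul, LinearMap.lTensor_tmul,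
    LinearMap.lTensor_tmul] at h'
  refine ⟨F (Coalgebra.comul (R := k) y) - F (y ⊗ₜ[k] (1 : A)), ?_⟩
  have h3 : F (x ⊗ₜ[k] y) = x := by simp [F, hf]
  rw [h3] at h'
  rw [TensorProduct.tmul_sub, ← add_sub_assoc, eq_sub_iff_add_eq, add_comm, h', add_comm]

/-- If all group-like elements are trivial, coassociativity forces `x ⊗ y` to be a coboundary or
`x` and `y` to be primitive. -/
theorem coboundary_or_primitive_of_coassoc (hG : ∀ w : A, IsGroupLikeElem k w → w = 1) {x y : A}
    (h : x ⊗ₜ[k] (y ⊗ₜ[k] (1 : A)) +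
      TensorProduct.assoc k _ _ _ (Coalgebra.comul (R := k) x ⊗ₜ[k] y) =
      x ⊗ₜ[k] Coalgebra.comul (R := k) y + (1 : A) ⊗ₜ[k] (x ⊗ₜ[k] y)) :
    (∃ c : A, x ⊗ₜ[k] y + Coalgebra.comul (R := k) c = c ⊗ₜ[k] (1 : A) + (1 : A) ⊗ₜ[k] c) ∨
      (x ≠ 0 ∧ y ≠ 0 ∧ IsSkewPrimitive k 1 1 x ∧ IsSkewPrimitive k 1 1 y) := by
  by_cases hx : x = 0
  · exact Or.inl ⟨0, by simp [hx]⟩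
  by_cases hy : y = 0
  · exact Or.inl ⟨0, by simp [hy]⟩
  obtain ⟨w, hw⟩ := exists_comul_eq_of_coassoc hy h
  -- With `Δ(x) = 1 ⊗ x + x ⊗ w`, the counit axioms give `ε(x) w = 0`, and also `ε(w) = 1` when
  -- `ε(x) = 0`. So either `w` is group-like, or `w = 0` and both `x` and `y` are scalars.
  by_cases hε : Coalgebra.counit (R := k) x = 0
  · right
    have hw1 : w = 1 := by
      refine hG w ⟨?_, ?_⟩
      · have h1 := congrArg (TensorProduct.rid k A) (Coalgebra.lTensor_counit_comul (R := k) x)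
        rw [hw] at h1
        simp only [map_add, LinearMap.lTensor_tmul, TensorProduct.rid_tmul, hε, zero_smul, zero_add,
          one_smul] at h1
        have h2 : (Coalgebra.counit (R := k) w - 1) • x = 0 := by rw [sub_smul, h1, one_smul, sub_self]
        exact sub_eq_zero.mp ((smul_eq_zero.mp h2).resolve_right hx)
      · have h1 := Coalgebra.coassoc_apply (R := k) x
        rw [hw] at h1
        simp only [map_add, LinearMap.rTensor_tmul, LinearMap.lTensor_tmul, hw, Bialgebra.comul_one,
          Algebra.TensorProduct.one_def, TensorProduct.add_tmul, TensorProduct.tmul_add,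
          TensorProduct.assoc_tmul, add_assoc, add_right_inj] at h1
        exact (tmul_left_cancel hx h1).symm
    rw [hw1, add_comm] at hw
    refine ⟨hx, hy, hw, ?_⟩
    rw [hw, TensorProduct.add_tmul, map_add, TensorProduct.assoc_tmul, TensorProduct.assoc_tmul,
      ← add_assoc, add_left_inj, ← TensorProduct.tmul_add] at h
    exact (tmul_left_cancel hx h).symm
  · left
    have hw0 : w = 0 := by
      have h1 := congrArg (TensorProduct.lid k A) (Coalgebra.rTensor_counit_comul (R := k) x)
      rw [hw] at h1
      simpa [hε] using h1
    rw [hw0, TensorProduct.tmul_zero, add_zero] at hw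
    have hx1 := eq_algebraMap_of_comul_eq_one_tmul hw
    have hy1 : Coalgebra.comul (R := k) y = y ⊗ₜ[k] (1 : A) := by
      rw [hw, TensorProduct.assoc_tmul, add_left_inj] at h
      exact (tmul_left_cancel hx h).symm
    have hy2 := eq_algebraMap_of_comul_eq_tmul_one hy1
    generalize Coalgebra.counit (R := k) x = r at hx1
    generalize Coalgebra.counit (R := k) y = r' at hy2
    subst hx1 hy2
    -- For scalars, `x ⊗ y = r r' (1 ⊗ 1)` is the coboundary of the scalar `r r'`.
    refine ⟨algebraMap k A (r * r'), ?_⟩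
    rw [Bialgebra.comul_algebraMap]
    simp only [Algebra.algebraMap_eq_smul_one, Algebra.TensorProduct.one_def,
      TensorProduct.smul_tmul', TensorProduct.tmul_smul, smul_smul, mul_comm r]

end

namespace GeneralizedHopfOreExtension

variable {k : Type u} [Field k] {A : Type v} [Ring A] [HopfAlgebra k A]
  (E : GeneralizedHopfOreExtension.{u, v, w} k A)

/-- The change of variable `z ↦ z + c` that turns `x ⊗ y` into `0`. -/
def removeCoboundary (h₁ : E.r₁ = 1) (h₂ : E.r₂ = 1) (c : A)
    (h : E.x ⊗ₜ[k] E.y + Coalgebra.comul (R := k) c = c ⊗ₜ[k] (1 : A) + (1 : A) ⊗ₜ[k] c) :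
    GeneralizedHopfOreExtension.{u, v, w} k A where
  τ := E.τ
  δ := OreExtension.translateδ E.τ E.δ c
  δ_mul a b := by
    simp only [OreExtension.translateδ_apply, map_mul, E.δ_mul]
    noncomm_ring
  carrier := E.carrier
  e := (OreExtension.translate E.τ E.δ c).trans E.e
  r₁ := 1
  r₂ := 1
  x := 0
  y := 0
  counit_of a := by
    rw [AlgEquiv.trans_apply, OreExtension.translate_of]
    exact E.counit_of a
  comul_of a := by
    have hc : ((OreExtension.translate E.τ E.δ c).trans E.e).toAlgHom.comp
        (OreExtension.of E.τ _) = E.incl :=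
      AlgHom.ext fun a => congrArg E.e (OreExtension.translate_of _ _)
    rw [hc, AlgEquiv.trans_apply, OreExtension.translate_of]
    exact E.comul_of a
  comul_z := by
    simp only [AlgEquiv.trans_apply, OreExtension.translate_of, OreExtension.translate_z]
    rw [map_add E.e, map_add (Coalgebra.comul (R := k))]
    have h' := congrArg (TensorProduct.map E.incl.toLinearMap E.incl.toLinearMap) h
    simp only [map_add, TensorProduct.map_tmul, ← E.comul_incl, AlgHom.toLinearMap_apply,
      map_one] at h'
    have hz := E.comul_var
    simp only [h₁, h₂, map_one] at hz
    change Coalgebra.comul (R := k) E.var + Coalgebra.comul (R := k) (E.incl c) =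
      (E.var + E.incl c) ⊗ₜ[k] E.incl 1 + E.incl 0 ⊗ₜ[k] E.incl 0 +
        E.incl 1 ⊗ₜ[k] (E.var + E.incl c)
    rw [hz, map_one, map_zero, TensorProduct.tmul_zero, add_zero, TensorProduct.add_tmul,
      TensorProduct.tmul_add, add_right_comm _ _ (Coalgebra.comul (R := k) (E.incl c)),
      add_assoc (E.var ⊗ₜ[k] (1 : E.carrier)), h']
    abel

theorem isomorphic_removeCoboundary (h₁ : E.r₁ = 1) (h₂ : E.r₂ = 1) (c : A)
    (h : E.x ⊗ₜ[k] E.y + Coalgebra.comul (R := k) c = c ⊗ₜ[k] (1 : A) + (1 : A) ⊗ₜ[k] c) :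
    E.Isomorphic (E.removeCoboundary h₁ h₂ c h) := by
  refine ⟨BialgEquiv.refl k E.carrier, ?_⟩
  have hc : (E.removeCoboundary h₁ h₂ c h).incl = E.incl :=
    AlgHom.ext fun a => congrArg E.e (OreExtension.translate_of _ _)
  rw [hc]
  exact Set.image_id _

theorem isomorphic_refl : E.Isomorphic E :=
  ⟨BialgEquiv.refl k E.carrier, Set.image_id _⟩

/-! ### The twist and the derivation on primitive elements -/

theorem map_map_incl_mul (f₁ f₂ : E.carrier →ₗ[k] A) (s : A ⊗[k] A) (h h' : E.carrier) :
    TensorProduct.map f₁ f₂ (TensorProduct.map E.incl.toLinearMap E.incl.toLinearMap s *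
      h ⊗ₜ[k] h') =
    TensorProduct.map (f₁ ∘ₗ LinearMap.mulRight k h ∘ₗ E.incl.toLinearMap)
      (f₂ ∘ₗ LinearMap.mulRight k h' ∘ₗ E.incl.toLinearMap) s := by
  induction s using TensorProduct.induction_on with
  | zero => simp
  | add p q hp hq => simp only [map_add, add_mul, hp, hq]
  | tmul p q => simp

theorem coeff₁_comp_mulRight_var :
    E.coeff₁ ∘ₗ LinearMap.mulRight k E.var ∘ₗ E.incl.toLinearMap = LinearMap.id :=
  LinearMap.ext fun a => by simp

theorem coeff₀_comp_mulRight_var :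
    E.coeff₀ ∘ₗ LinearMap.mulRight k E.var ∘ₗ E.incl.toLinearMap = 0 :=
  LinearMap.ext fun a => by simp

theorem coeff₀_comp_mulRight_incl (b : A) :
    E.coeff₀ ∘ₗ LinearMap.mulRight k (E.incl b) ∘ₗ E.incl.toLinearMap = LinearMap.mulRight k b :=
  LinearMap.ext fun a => by simp [← map_mul]

theorem coeff₁_comp_mulRight_incl (b : A) :
    E.coeff₁ ∘ₗ LinearMap.mulRight k (E.incl b) ∘ₗ E.incl.toLinearMap = 0 :=
  LinearMap.ext fun a => by simp [← map_mul]

theorem map_mulRight_eq_mul (s : A ⊗[k] A) (x y : A) :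
    TensorProduct.map (LinearMap.mulRight k x) (LinearMap.mulRight k y) s = s * x ⊗ₜ[k] y := by
  induction s using TensorProduct.induction_on with
  | zero => simp
  | add p q hp hq => simp only [map_add, add_mul, hp, hq]
  | tmul p q => simp

variable {E} (h₁ : E.r₁ = 1) (h₂ : E.r₂ = 1) {a : A} (ha : IsSkewPrimitive k 1 1 a)

include h₁ h₂ ha

/-- Multiplicativity of `Δ` on `z a = τ(a) z + δ(a)`. The `z ⊗ 1` part determines `Δ(τ(a))`, and the
part without `z` determines `Δ(δ(a))`. -/
theorem comul_var_mul :
    (E.var * E.incl a) ⊗ₜ[k] E.incl 1 + E.var ⊗ₜ[k] E.incl a +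
      (E.incl (E.x * a) ⊗ₜ[k] E.incl E.y + E.incl E.x ⊗ₜ[k] E.incl (E.y * a)) +
      (E.incl a ⊗ₜ[k] E.var + E.incl 1 ⊗ₜ[k] (E.var * E.incl a)) =
    TensorProduct.map E.incl.toLinearMap E.incl.toLinearMap (Coalgebra.comul (R := k) (E.τ a)) *
        E.var ⊗ₜ[k] E.incl 1 +
      TensorProduct.map E.incl.toLinearMap E.incl.toLinearMap (Coalgebra.comul (R := k) (E.τ a)) *
        E.incl E.x ⊗ₜ[k] E.incl E.y +
      TensorProduct.map E.incl.toLinearMap E.incl.toLinearMap (Coalgebra.comul (R := k) (E.τ a)) *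
        E.incl 1 ⊗ₜ[k] E.var +
      TensorProduct.map E.incl.toLinearMap E.incl.toLinearMap (Coalgebra.comul (R := k) (E.δ a)) := by
  have h := congrArg (Coalgebra.comul (R := k)) (E.var_mul_incl a)
  rw [map_add, Bialgebra.comul_mul, Bialgebra.comul_mul, comul_var, h₁, h₂, E.comul_incl (E.τ a),
    E.comul_incl (E.δ a), mul_add, mul_add] at h
  rw [← h, E.comul_incl, ha]
  simp only [map_add, TensorProduct.map_tmul, AlgHom.toLinearMap_apply, map_one, add_mul, mul_add,
    Algebra.TensorProduct.tmul_mul_tmul, mul_one, one_mul, map_mul]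
  abel

theorem comul_τ : Coalgebra.comul (R := k) (E.τ a) = E.τ a ⊗ₜ[k] (1 : A) + (1 : A) ⊗ₜ[k] a := by
  have h := congrArg (TensorProduct.map E.coeff₁ E.coeff₀) (comul_var_mul h₁ h₂ ha)
  simp only [map_add, map_map_incl_mul, map_map_incl, coeff₁_comp_mulRight_var,
    coeff₀_comp_mulRight_var, coeff₀_comp_mulRight_incl, coeff₁_comp_mulRight_incl,
    coeff₁_comp_incl, TensorProduct.map_zero_left, LinearMap.zero_apply, add_zero,
    TensorProduct.map_tmul, var_mul_incl, coeff₁_incl_mul_var, coeff₁_incl, coeff₀_incl,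
    coeff₁_var, coeff₀_var, TensorProduct.zero_tmul, LinearMap.mulRight_one,
    TensorProduct.map_id, LinearMap.id_apply, TensorProduct.tmul_zero] at h
  exact h.symm

/-- Apply the counit to the first leg of `Δ(τ(a)) = τ(a) ⊗ 1 + 1 ⊗ a`. -/
theorem τ_eq_add : E.τ a = a + Coalgebra.counit (R := k) (E.τ a) • (1 : A) := by
  have h := congrArg (TensorProduct.lid k A) (Coalgebra.rTensor_counit_comul (R := k) (E.τ a))
  rw [comul_τ h₁ h₂ ha] at h
  simp only [map_add, LinearMap.rTensor_tmul, TensorProduct.lid_tmul, Bialgebra.counit_one,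
    one_smul] at h
  rw [add_comm]
  exact h.symm

/-- The defect comes from moving `x ⊗ y` past `a`: it is `(x ⊗ y) Δ(a) - Δ(τ(a)) (x ⊗ y)`, and
`τ(a)` differs from `a` by a scalar. -/
theorem comul_δ : Coalgebra.comul (R := k) (E.δ a) =
    E.δ a ⊗ₜ[k] (1 : A) + (1 : A) ⊗ₜ[k] E.δ a + ((E.x * a - a * E.x) ⊗ₜ[k] E.y +
      E.x ⊗ₜ[k] (E.y * a - a * E.y) - Coalgebra.counit (R := k) (E.τ a) • E.x ⊗ₜ[k] E.y) := by
  have h := congrArg (TensorProduct.map E.coeff₀ E.coeff₀) (comul_var_mul h₁ h₂ ha)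
  simp only [map_add, map_map_incl_mul, map_map_incl,
    coeff₀_comp_mulRight_var, coeff₀_comp_mulRight_incl,
    coeff₀_comp_incl, TensorProduct.map_zero_left, TensorProduct.map_zero_right,
    LinearMap.zero_apply, add_zero, zero_add, TensorProduct.map_tmul, var_mul_incl,
    coeff₀_incl_mul_var, coeff₀_incl, coeff₀_var, TensorProduct.zero_tmul,
    TensorProduct.map_id, LinearMap.id_apply, TensorProduct.tmul_zero,
    map_mulRight_eq_mul] at h
  rw [comul_τ h₁ h₂ ha, τ_eq_add h₁ h₂ ha] at h
  simp only [TensorProduct.add_tmul, add_mul, Algebra.TensorProduct.tmul_mul_tmul, one_mul,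
    smul_mul_assoc, ← TensorProduct.smul_tmul'] at h
  rw [← sub_eq_iff_eq_add'] at h
  rw [← h, TensorProduct.sub_tmul, TensorProduct.tmul_sub]
  abel

end GeneralizedHopfOreExtension

end

noncomputable section

attribute [local instance 100] LieRing.ofAssociativeRing
attribute [-simp] UniversalEnvelopingAlgebra.ι_apply

/-! ### Generalized Hopf-Ore extensions of enveloping algebras -/

namespace HopfOreChar2

variable {k : Type u} [Field k] {g : Type v} [LieRing g] [LieAlgebra k g]

local notation "U" => UniversalEnvelopingAlgebra k g
local notation "ιU" => UniversalEnvelopingAlgebra.ι k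
local notation "ĝ" => restrictedHull k g 2

theorem isSkewPrimitive_ι (u : g) : IsSkewPrimitive k 1 1 (ιU u : U) := by
  rw [IsSkewPrimitive, UEAHopf.comul_eq, UEAHopf.comulHom_ι]

theorem isSkewPrimitive_zero {A : Type v} [Ring A] [HopfAlgebra k A] :
    IsSkewPrimitive k (1 : A) 1 0 := by
  simp [IsSkewPrimitive]

theorem ι_sq_mem_restrictedHull (u : g) : (ιU u : U) * ιU u ∈ ĝ :=
  Submodule.subset_span ⟨u, 1, by rw [pow_one, sq]⟩

/-- For `r = 1` the twist is itself an algebra map, so agreement on `g` suffices. -/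
theorem eq_characterTwist {τ : U →ₐ[k] U} {χ : U →ₐ[k] k}
    (h : ∀ u : g, τ (ιU u) = ιU u + χ (ιU u) • (1 : U)) (w : U) :
    τ w = characterTwist χ 1 w := by
  let F : U →ₐ[k] U := (Algebra.TensorProduct.lid k U).toAlgHom.comp
    ((Algebra.TensorProduct.map χ (AlgHom.id k U)).comp (Bialgebra.comulAlgHom k U))
  have hF : ∀ w, F w = characterTwist χ 1 w := by
    intro w
    have hid : LinearMap.mulRight k (HopfAlgebra.antipode k (1 : U)) ∘ₗ
        LinearMap.mulLeft k (1 : U) = LinearMap.id := by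
      ext w
      simp
    rw [characterTwist, hid]
    rfl
  rw [← hF]
  refine DFunLike.congr_fun (UEAHopf.algHom_ext fun u => ?_) w
  rw [hF, h, characterTwist]
  simp only [LinearMap.comp_apply]
  rw [isSkewPrimitive_ι u]
  simp [add_comm]

section

variable (E : GeneralizedHopfOreExtension.{u, max u v, w} k (UniversalEnvelopingAlgebra.{u, v} k g))

/-- The character `χ` with `τ(u) = u + χ(u)`. -/
def twistCharacter : U →ₐ[k] k := (Bialgebra.counitAlgHom k U).comp E.τ

variable {E} (h₁ : E.r₁ = 1) (h₂ : E.r₂ = 1)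

include h₁ h₂

theorem τ_ι (u : g) : E.τ (ιU u) = ιU u + twistCharacter E (ιU u) • (1 : U) :=
  E.τ_eq_add h₁ h₂ (isSkewPrimitive_ι u)

theorem δ_lie (u v : g) : E.δ (ιU ⁅u, v⁆) =
    (E.δ (ιU u) * ιU v - ιU v * E.δ (ιU u)) + (ιU u * E.δ (ιU v) - E.δ (ιU v) * ιU u) +
      twistCharacter E (ιU u) • E.δ (ιU v) - twistCharacter E (ιU v) • E.δ (ιU u) := by
  rw [LieHom.map_lie, LieRing.of_associative_ring_bracket, map_sub, E.δ_mul, E.δ_mul,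
    τ_ι h₁ h₂, τ_ι h₁ h₂, add_mul, add_mul, smul_one_mul, smul_one_mul]
  abel

theorem hasForm (hx : IsSkewPrimitive k 1 1 E.x) (hy : IsSkewPrimitive k 1 1 E.y)
    (hxy : E.x = 0 ↔ E.y = 0) : E.HasForm (twistCharacter E) 1 1 E.x E.y where
  r₁_eq := h₁
  r₂_eq := h₂
  x_eq := rfl
  y_eq := rfl
  normalized :=
    { groupLike₁ := E.isGroupLikeElem_r₁
      groupLike₂ := E.isGroupLikeElem_r₂
      primitive_x := by rwa [h₂]
      primitive_y := by rwa [h₁]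
      x_eq_zero_iff := hxy }
  τ_eq := eq_characterTwist (τ_ι h₁ h₂)

theorem comul_δ_ι (u : g) : Coalgebra.comul (R := k) (E.δ (ιU u)) =
    E.δ (ιU u) ⊗ₜ[k] (1 : U) + (1 : U) ⊗ₜ[k] E.δ (ιU u) +
      ((E.x * ιU u - ιU u * E.x) ⊗ₜ[k] E.y + E.x ⊗ₜ[k] (E.y * ιU u - ιU u * E.y) -
        twistCharacter E (ιU u) • E.x ⊗ₜ[k] E.y) :=
  E.comul_δ h₁ h₂ (isSkewPrimitive_ι u)

end

open TwoDimEnveloping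

variable [CharP k 2] {B : Module.Basis (Fin 2) k g}
  {E : GeneralizedHopfOreExtension.{u, max u v, w} k (UniversalEnvelopingAlgebra.{u, v} k g)}

omit [CharP k 2] in
theorem δ_mem_of_basis (ha : E.δ (ιU (B 0)) ∈ ĝ) (hb : E.δ (ιU (B 1)) ∈ ĝ) (u : g) :
    E.δ (ιU u) ∈ ĝ := by
  rw [basis_expand B u]
  simp only [map_add, map_smul]
  exact add_mem (Submodule.smul_mem _ _ ha) (Submodule.smul_mem _ _ hb)

section

variable {c : k} (hB : ⁅B 0, B 1⁆ = c • B 0)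

include hB

theorem r₁_eq_one : E.r₁ = 1 := eq_one_of_isGroupLikeElem hB E.isGroupLikeElem_r₁

theorem r₂_eq_one : E.r₂ = 1 := eq_one_of_isGroupLikeElem hB E.isGroupLikeElem_r₂

theorem familyA_of_eq_zero (hx : E.x = 0) (hy : E.y = 0) : FamilyA (B 0) (B 1) E := by
  have h₁ := r₁_eq_one hB (E := E)
  have h₂ := r₂_eq_one hB (E := E)
  have h := hasForm h₁ h₂ (by rw [hx]; exact isSkewPrimitive_zero)
    (by rw [hy]; exact isSkewPrimitive_zero) (by rw [hx, hy])
  rw [hx, hy] at h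
  refine ⟨twistCharacter E, h, fun u => ?_, δ_lie h₁ h₂ _ _⟩
  refine mem_restrictedHull_of_primitive hB ?_
  have h := comul_δ_ι h₁ h₂ u
  rw [hx, hy] at h
  rw [IsSkewPrimitive]
  simpa using h

theorem exists_familyA_of_coboundary {d : U} (h : E.x ⊗ₜ[k] E.y + Coalgebra.comul (R := k) d =
      d ⊗ₜ[k] (1 : U) + (1 : U) ⊗ₜ[k] d) :
    ∃ E' : GeneralizedHopfOreExtension.{u, max u v, w} k U,
      E.Isomorphic E' ∧ FamilyA (B 0) (B 1) E' :=
  ⟨_, E.isomorphic_removeCoboundary (r₁_eq_one hB) (r₂_eq_one hB) d h,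
    familyA_of_eq_zero hB rfl rfl⟩

end

/-- The commutators in `Δ(δ(u))` vanish, so the only defect is `-χ(u) x ⊗ y`. If some `χ(u) ≠ 0`,
then `χ(u)⁻¹ δ(u)` exhibits `x ⊗ y` as a coboundary, and a change of variable leads to family (a).
-/
theorem familyA_or_familyB (hB : ⁅B 0, B 1⁆ = 0) (hx0 : E.x ≠ 0) (hy0 : E.y ≠ 0)
    (hx : IsSkewPrimitive k 1 1 E.x) (hy : IsSkewPrimitive k 1 1 E.y) :
    ∃ E' : GeneralizedHopfOreExtension.{u, max u v, w} k U,
      E.Isomorphic E' ∧ (FamilyA (B 0) (B 1) E' ∨ FamilyB (B 0) (B 1) E') := by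
  have hB0 : ⁅B 0, B 1⁆ = (0 : k) • B 0 := by rw [hB, zero_smul]
  have h₁ := r₁_eq_one hB0 (E := E)
  have h₂ := r₂_eq_one hB0 (E := E)
  have hδ : ∀ u : g, Coalgebra.comul (R := k) (E.δ (ιU u)) =
      E.δ (ιU u) ⊗ₜ[k] (1 : U) + (1 : U) ⊗ₜ[k] E.δ (ιU u) -
        twistCharacter E (ιU u) • E.x ⊗ₜ[k] E.y := by
    intro u
    rw [comul_δ_ι h₁ h₂, commute_ι_of_abelian hB, commute_ι_of_abelian hB, sub_self, sub_self,
      TensorProduct.zero_tmul, TensorProduct.tmul_zero]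
    abel
  by_cases hχ : ∀ u : g, twistCharacter E (ιU u) = 0
  · refine ⟨E, E.isomorphic_refl, Or.inr ⟨hB, twistCharacter E, E.x, E.y,
      hasForm h₁ h₂ hx hy (by simp [hx0, hy0]), hχ, mem_restrictedHull_of_primitive hB0 hx,
      mem_restrictedHull_of_primitive hB0 hy, hx0, hy0, fun u => ?_⟩⟩
    refine mem_restrictedHull_of_primitive hB0 ?_
    have h := hδ u
    rwa [hχ, zero_smul, sub_zero] at h
  · push Not at hχ
    obtain ⟨u, hu⟩ := hχ
    obtain ⟨E', hE, hA⟩ := exists_familyA_of_coboundary (E := E) hB0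
      (d := (twistCharacter E (ιU u))⁻¹ • E.δ (ιU u)) (by
        rw [map_smul, hδ, smul_sub, smul_smul, inv_mul_cancel₀ hu, one_smul, add_sub_cancel,
          smul_add, TensorProduct.smul_tmul', TensorProduct.tmul_smul])
    exact ⟨E', hE, Or.inl hA⟩

/-! ### The case `[a,b] = a`: families (c) and (d) -/

section

variable {c : k} (hB : ⁅B 0, B 1⁆ = c • B 0)

theorem coeff_zero_of_primitive {x : U} (hx : IsSkewPrimitive k 1 1 x) : coeff hB 0 x = 0 :=
  coeff_eq_zero_of_primitive hB hx
    (fun r h => by simpa using (congrArg Prod.fst h).symm)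
    (fun r h => by simpa using (congrArg Prod.snd h).symm)

theorem exists_coeff_ne_zero {x : U} (hx : IsSkewPrimitive k 1 1 x) (hx0 : x ≠ 0) :
    ∃ p ∈ {p : ℕ × ℕ | p ≠ 0}, coeff hB p x ≠ 0 := by
  by_contra h
  push Not at h
  refine hx0 (ext_coeff hB fun p => ?_)
  rw [map_zero]
  by_cases hp : p = 0
  · rw [hp, coeff_zero_of_primitive hB hx]
  · exact h p hp

/-- A primitive element with no coefficient besides that of `a` is a multiple of `a`. -/
theorem eq_smul_of_coeff_eq_zero {x : U} (hx : IsSkewPrimitive k 1 1 x)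
    (h : ∀ p ∈ {p : ℕ × ℕ | p ≠ 0}, p ≠ (1, 0) → coeff hB p x = 0) :
    x = coeffsA hB x 0 • (ιU (B 0) : U) := by
  refine ext_coeff hB fun p => ?_
  rw [map_smul, coeff_ι_zero, coeffsA_apply]
  by_cases hp : p = 0
  · rw [hp, coeff_zero_of_primitive hB hx, if_neg (by simp), smul_zero]
  · by_cases hp1 : p = (1, 0)
    · simp [hp1]
    · rw [h p hp hp1, if_neg (Ne.symm hp1), smul_zero]

omit [CharP k 2] in
theorem coeffSum_coeffsB_smul (r : k) :
    coeffSum (coeffsB hB (r • (ιU (B 0) : U))) = 0 := by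
  have h : coeffsB hB (r • (ιU (B 0) : U)) = 0 := by
    ext i
    rw [coeffsB_apply, map_smul, coeff_ι_zero, if_neg (by simp), smul_zero, Finsupp.zero_apply]
  rw [h]
  simp [coeffSum]

end

/-- For primitive `a` and `x`, the product `a x` has defect `a ⊗ x + x ⊗ a`; subtracting the right
multiple makes `d` primitive. -/
theorem sub_smul_mem_restrictedHull {c : k} (hB : ⁅B 0, B 1⁆ = c • B 0) {d x : U}
    (hx : IsSkewPrimitive k 1 1 x) {s : k}
    (h : Coalgebra.comul (R := k) d = d ⊗ₜ[k] (1 : U) + (1 : U) ⊗ₜ[k] d +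
      s • ((ιU (B 0) : U) ⊗ₜ[k] x + x ⊗ₜ[k] (ιU (B 0) : U))) :
    d - s • ((ιU (B 0) : U) * x) ∈ ĝ := by
  refine mem_restrictedHull_of_primitive hB ?_
  have ha := isSkewPrimitive_ι (k := k) (B 0)
  rw [IsSkewPrimitive] at ha hx ⊢
  rw [map_sub, map_smul, Bialgebra.comul_mul, h, ha, hx]
  simp only [add_mul, mul_add, Algebra.TensorProduct.tmul_mul_tmul, mul_one, one_mul,
    TensorProduct.sub_tmul, TensorProduct.tmul_sub, ← TensorProduct.smul_tmul',
    TensorProduct.tmul_smul, smul_add]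
  abel

/-- The defect of `δ(a)` is `α' a ⊗ y + β' x ⊗ a`, and that of `δ(b)` is `α₀ a ⊗ y + β₀ x ⊗ a - χ(b)
x ⊗ y`. Both are symmetric with zero diagonal, and this restriction yields the conditions of the
families with no change of variable. -/
theorem familyC_or_familyD (hB : ⁅B 0, B 1⁆ = B 0) (hx0 : E.x ≠ 0) (hy0 : E.y ≠ 0)
    (hx : IsSkewPrimitive k 1 1 E.x) (hy : IsSkewPrimitive k 1 1 E.y) :
    FamilyC (B 0) (B 1) E ∨ FamilyD (B 0) (B 1) E := by
  have hB1 : ⁅B 0, B 1⁆ = (1 : k) • B 0 := by rw [hB, one_smul]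
  have h₁ := r₁_eq_one hB1 (E := E)
  have h₂ := r₂_eq_one hB1 (E := E)
  have hform := hasForm h₁ h₂ hx hy (by simp [hx0, hy0])
  set χ := twistCharacter E with hχ
  -- A character kills commutators, and `a = [a,b]`.
  have hχa : χ (ιU (B 0)) = 0 := by
    rw [← hB, LieHom.map_lie, LieRing.of_associative_ring_bracket, map_sub, map_mul, map_mul,
      mul_comm, sub_self]
  have hlie := δ_lie h₁ h₂ (E := E) (B 0) (B 1)
  rw [hB, ← hχ, hχa, zero_smul, add_zero] at hlie
  have hxc := eq_combination_of_primitive hB1 hx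
  have hyc := eq_combination_of_primitive hB1 hy
  have hδa := comul_δ_ι h₁ h₂ (E := E) (B 0)
  have hδb := comul_δ_ι h₁ h₂ (E := E) (B 1)
  have hxa := combination_lie_zero hB (coeffsA hB1 E.x) (coeffsB hB1 E.x)
  have hya := combination_lie_zero hB (coeffsA hB1 E.y) (coeffsB hB1 E.y)
  have hxb := combination_lie_one hB (coeffsA hB1 E.x) (coeffsB hB1 E.x)
  have hyb := combination_lie_one hB (coeffsA hB1 E.y) (coeffsB hB1 E.y)
  rw [← hxc] at hxa hxb
  rw [← hyc] at hya hyb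
  rw [← hχ, hχa, zero_smul, sub_zero, hxa, hya] at hδa
  rw [← hχ, hxb, hyb] at hδb
  have hN : ((1, 0) : ℕ × ℕ) ∈ {p : ℕ × ℕ | p ≠ 0} := by simp
  have hA1 : coeff hB1 (1, 0) (ιU (B 0)) = 1 := by rw [coeff_ι_zero, if_pos rfl]
  have hA : ∀ p, p ≠ (1, 0) → coeff hB1 p (ιU (B 0)) = 0 := fun p hp => by
    rw [coeff_ι_zero, if_neg (Ne.symm hp)]
  have smul_eq : ∀ s t : k,
      (∀ p ∈ {p : ℕ × ℕ | p ≠ 0}, s * coeff hB1 p E.y = t * coeff hB1 p E.x) →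
      s • E.y = t • E.x := by
    intro s t h
    refine ext_coeff hB1 fun p => ?_
    rw [map_smul, map_smul, smul_eq_mul, smul_eq_mul]
    by_cases hp : p = 0
    · rw [hp, coeff_zero_of_primitive hB1 hx, coeff_zero_of_primitive hB1 hy, mul_zero, mul_zero]
    · exact h p hp
  have hprime : coeffSum (coeffsB hB1 E.x) • E.y = coeffSum (coeffsB hB1 E.y) • E.x := by
    refine smul_eq _ _ fun p hp => smul_eq_smul_of_symm
          (X := fun p => coeff hB1 p E.x) (Y := fun p => coeff hB1 p E.y)
          (A := fun p => coeff hB1 p (ιU (B 0))) hN hA1 hA ?_ ?_ hp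
    · intro p hp q hq
      have h := coeff₂_symm hB1 hδa hp hq
      simp only [map_add, coeff₂_tmul, map_smul, smul_eq_mul] at h
      linear_combination h
    · intro p hp
      have h := coeff₂_self_eq_zero hB1 hδa hp
      simp only [map_add, coeff₂_tmul, map_smul, smul_eq_mul] at h
      linear_combination h
  have hmema : E.δ (ιU (B 0)) - coeffSum (coeffsB hB1 E.y) • ((ιU (B 0) : U) * E.x) ∈ ĝ := by
    refine sub_smul_mem_restrictedHull hB1 hx ?_
    rw [hδa, ← TensorProduct.smul_tmul', ← TensorProduct.tmul_smul, hprime,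
      TensorProduct.tmul_smul, TensorProduct.tmul_smul, smul_add]
  by_cases hl : χ (ιU (B 1)) = 0
  · left
    rw [hl, zero_smul, sub_zero] at hlie hδb
    have hzero : coeffsA hB1 E.x 0 • E.y = coeffsA hB1 E.y 0 • E.x := by
      refine smul_eq _ _ fun p hp => smul_eq_smul_of_symm
          (X := fun p => coeff hB1 p E.x) (Y := fun p => coeff hB1 p E.y)
          (A := fun p => coeff hB1 p (ιU (B 0))) hN hA1 hA ?_ ?_ hp
      · intro p hp q hq
        have h := coeff₂_symm hB1 hδb hp hq
        simp only [map_add, coeff₂_tmul, map_smul, smul_eq_mul] at h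
        linear_combination h
      · intro p hp
        have h := coeff₂_self_eq_zero hB1 hδb hp
        simp only [map_add, coeff₂_tmul, map_smul, smul_eq_mul] at h
        linear_combination h
    have hmemb : E.δ (ιU (B 1)) - coeffsA hB1 E.y 0 • ((ιU (B 0) : U) * E.x) ∈ ĝ := by
      refine sub_smul_mem_restrictedHull hB1 hx ?_
      rw [hδb, ← TensorProduct.smul_tmul', ← TensorProduct.tmul_smul, hzero,
        TensorProduct.tmul_smul, TensorProduct.tmul_smul, smul_add]
    have hχu : ∀ u : g, χ (ιU u) = 0 := by
      intro u
      rw [basis_expand B u]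
      simp [hχa, hl]
    refine ⟨hB, χ, _, _, _, _, E.x, E.y, hxc, hyc, hform, hχu, hx0, hy0, hzero, hprime, hlie, ?_⟩
    by_cases hxs : E.x = coeffsA hB1 E.x 0 • (ιU (B 0) : U)
    · left
      have hα : coeffsA hB1 E.x 0 ≠ 0 := by
        intro h
        -- In case (i), `x = α₀ a` with `α₀ ≠ 0`, so `α₀ y = β₀ x` gives `y = β₀ a`; the correction
        -- terms disappear, since `β' = 0` and `a x` is a multiple of `a²`, which lies in `ĝ`.
        rw [h, zero_smul] at hxs
        exact hx0 hxs
      have hys : E.y = coeffsA hB1 E.y 0 • (ιU (B 0) : U) := by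
        refine smul_right_injective U hα ?_
        change coeffsA hB1 E.x 0 • E.y = coeffsA hB1 E.x 0 • coeffsA hB1 E.y 0 • (ιU (B 0) : U)
        rw [hzero]
        conv_lhs => rw [hxs]
        rw [smul_comm]
      have hβ : coeffSum (coeffsB hB1 E.y) = 0 := by
        rw [hys]
        exact coeffSum_coeffsB_smul hB1 _
      rw [hβ, zero_smul, sub_zero] at hmema
      refine ⟨hxs, hys, δ_mem_of_basis hmema ?_⟩
      have hsq : coeffsA hB1 E.y 0 • ((ιU (B 0) : U) * E.x) ∈ ĝ := by
        refine Submodule.smul_mem _ _ ?_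
        rw [hxs, mul_smul_comm]
        exact Submodule.smul_mem _ _ (ι_sq_mem_restrictedHull _)
      simpa using add_mem hmemb hsq
    · exact Or.inr ⟨hxs, hmema, hmemb⟩
  · right
    have hcase := eq_one_of_symm (N := {p : ℕ × ℕ | p ≠ 0}) (X := fun p => coeff hB1 p E.x)
      (Y := fun p => coeff hB1 p E.y) (A := fun p => coeff hB1 p (ιU (B 0))) hN hA1 hA
      -- Here `X e = α₀` and `Y e = β₀`, so the tensor in `eq_one_of_symm` is the defect of `δ(b)`.
      (l := - χ (ιU (B 1))) (neg_ne_zero.mpr hl) ?_ ?_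
      (exists_coeff_ne_zero hB1 hx hx0) (exists_coeff_ne_zero hB1 hy hy0)
    · obtain ⟨hl1, hcase⟩ := hcase
      rw [neg_eq_of_char_two k] at hl1
      rw [hl1, one_smul] at hlie hδb
      have hcomm : (E.δ (ιU (B 0)) * ιU (B 1) - ιU (B 1) * E.δ (ιU (B 0))) +
          (ιU (B 0) * E.δ (ιU (B 1)) - E.δ (ιU (B 1)) * ιU (B 0)) = 0 := by
        -- With `χ(b) = 1` the bracket condition has `δ(a)` on both sides, and `δ(a) + δ(a) = 0`.
        rw [eq_sub_iff_add_eq, add_self_eq_zero_of_char_two k] at hlie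
        exact hlie.symm
      have hfin : (E.x = coeffsA hB1 E.x 0 • (ιU (B 0) : U) ∧ coeffsA hB1 E.y 0 = 0 ∧
            coeffSum (coeffsB hB1 E.y) = 0) ∨
          (coeffsA hB1 E.x 0 = 0 ∧ coeffSum (coeffsB hB1 E.x) = 0 ∧
            E.y = coeffsA hB1 E.y 0 • (ιU (B 0) : U)) := by
        rcases hcase with ⟨hye, hxp⟩ | ⟨hxe, hyp⟩
        · left
          have hxs := eq_smul_of_coeff_eq_zero hB1 hx hxp
          have hα : coeffSum (coeffsB hB1 E.x) = 0 := by
            rw [hxs]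
            exact coeffSum_coeffsB_smul hB1 _
          rw [hα, zero_smul] at hprime
          exact ⟨hxs, hye, (smul_eq_zero.mp hprime.symm).resolve_right hx0⟩
        · right
          have hys := eq_smul_of_coeff_eq_zero hB1 hy hyp
          have hβ : coeffSum (coeffsB hB1 E.y) = 0 := by
            rw [hys]
            exact coeffSum_coeffsB_smul hB1 _
          rw [hβ, zero_smul] at hprime
          exact ⟨hxe, (smul_eq_zero.mp hprime).resolve_right hy0, hys⟩
      have hβ : coeffSum (coeffsB hB1 E.y) = 0 := by
        rcases hfin with h | h
        · exact h.2.2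
        · rw [h.2.2]
          exact coeffSum_coeffsB_smul hB1 _
      rw [hβ, zero_smul, sub_zero] at hmema
      have hmemb : E.δ (ιU (B 1)) ∈ ĝ := by
        refine mem_restrictedHull_of_primitive hB1 ?_
        -- In either subcase one of the first two terms vanishes and the other equals `x ⊗ y`, so
        -- `δ(b)` is primitive.
        have h0 : (coeffsA hB1 E.x 0 • (ιU (B 0) : U)) ⊗ₜ[k] E.y +
            E.x ⊗ₜ[k] (coeffsA hB1 E.y 0 • (ιU (B 0) : U)) - E.x ⊗ₜ[k] E.y = 0 := by
          rcases hfin with ⟨hxs, hy1, -⟩ | ⟨hx1, -, hys⟩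
          · rw [← hxs, hy1, zero_smul, TensorProduct.tmul_zero, add_zero, sub_self]
          · rw [← hys, hx1, zero_smul, TensorProduct.zero_tmul, zero_add, sub_self]
        rw [h0, add_zero] at hδb
        exact hδb
      exact ⟨hB, χ, _, _, _, _, E.x, E.y, hxc, hyc, hform, hχa, hl1, hx0, hy0,
        δ_mem_of_basis hmema hmemb, hcomm, hfin⟩
    · intro p hp q hq
      have h := coeff₂_symm hB1 hδb hp hq
      simp only [map_add, map_sub, coeff₂_tmul, map_smul, smul_eq_mul] at h
      change coeffsA hB1 E.x 0 * _ + coeffsA hB1 E.y 0 * _ + _ =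
        coeffsA hB1 E.x 0 * _ + coeffsA hB1 E.y 0 * _ + _
      linear_combination h
    · intro p hp
      have h := coeff₂_self_eq_zero hB1 hδb hp
      simp only [map_add, map_sub, coeff₂_tmul, map_smul, smul_eq_mul] at h
      change coeffsA hB1 E.x 0 * _ + coeffsA hB1 E.y 0 * _ + _ = 0
      linear_combination h

theorem exists_isomorphic_family (hB : ⁅B 0, B 1⁆ = 0 ∨ ⁅B 0, B 1⁆ = B 0)
    (E : GeneralizedHopfOreExtension.{u, max u v, w} k U) :
    ∃ E' : GeneralizedHopfOreExtension.{u, max u v, w} k U, E.Isomorphic E' ∧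
      (FamilyA (B 0) (B 1) E' ∨ FamilyB (B 0) (B 1) E' ∨ FamilyC (B 0) (B 1) E' ∨
        FamilyD (B 0) (B 1) E') := by
  obtain ⟨c, hc⟩ : ∃ c : k, ⁅B 0, B 1⁆ = c • B 0 := by
    rcases hB with h | h
    · exact ⟨0, by rw [h, zero_smul]⟩
    · exact ⟨1, by rw [h, one_smul]⟩
  rcases coboundary_or_primitive_of_coassoc (fun w => eq_one_of_isGroupLikeElem hc)
    (E.coassoc_xy (r₁_eq_one hc) (r₂_eq_one hc)) with ⟨d, hd⟩ | ⟨hx0, hy0, hx, hy⟩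
  · obtain ⟨E', hE, hA⟩ := exists_familyA_of_coboundary hc hd
    exact ⟨E', hE, Or.inl hA⟩
  · rcases hB with hB | hB
    · obtain ⟨E', hE, hAB⟩ := familyA_or_familyB hB hx0 hy0 hx hy
      exact ⟨E', hE, hAB.imp_right Or.inl⟩
    · exact ⟨E, E.isomorphic_refl, Or.inr (Or.inr (familyC_or_familyD hB hx0 hy0 hx hy))⟩

end HopfOreChar2

end

noncomputable section

attribute [local instance 100] LieRing.ofAssociativeRing
attribute [-simp] UniversalEnvelopingAlgebra.ι_apply

/-! ### Bialgebra maps out of enveloping algebras -/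

theorem IsSkewPrimitive.add {k : Type u} [Field k] {A : Type v} [Ring A] [HopfAlgebra k A]
    {a b : A} (ha : IsSkewPrimitive k 1 1 a) (hb : IsSkewPrimitive k 1 1 b) :
    IsSkewPrimitive k 1 1 (a + b) := by
  rw [IsSkewPrimitive] at *
  rw [map_add, ha, hb, TensorProduct.add_tmul, TensorProduct.tmul_add]
  abel

theorem IsSkewPrimitive.smul {k : Type u} [Field k] {A : Type v} [Ring A] [HopfAlgebra k A]
    {a : A} (ha : IsSkewPrimitive k 1 1 a) (c : k) : IsSkewPrimitive k 1 1 (c • a) := by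
  rw [IsSkewPrimitive] at *
  rw [map_smul, ha, smul_add, TensorProduct.tmul_smul, TensorProduct.smul_tmul']

theorem IsSkewPrimitive.counit_eq_zero {k : Type u} [Field k] {A : Type v} [Ring A]
    [HopfAlgebra k A] {a : A} (ha : IsSkewPrimitive k 1 1 a) :
    Coalgebra.counit (R := k) a = 0 := by
  have h := congrArg (TensorProduct.lid k A) (Coalgebra.rTensor_counit_comul (R := k) a)
  rw [ha] at h
  simp only [map_add, LinearMap.rTensor_tmul, TensorProduct.lid_tmul, Bialgebra.counit_one,
    one_smul, add_eq_right] at h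
  simpa using congrArg (Coalgebra.counit (R := k)) h

namespace UEAHopf

variable {k : Type u} [Field k] {L : Type v} [LieRing L] [LieAlgebra k L]
  {H : Type w} [Ring H] [HopfAlgebra k H]

theorem counitAlgHom_comp_of_primitive {f : UniversalEnvelopingAlgebra k L →ₐ[k] H}
    (hf : ∀ l, IsSkewPrimitive k 1 1 (f (UniversalEnvelopingAlgebra.ι k l))) :
    (Bialgebra.counitAlgHom k H).comp f =
      Bialgebra.counitAlgHom k (UniversalEnvelopingAlgebra k L) :=
  algHom_ext fun l => (hf l).counit_eq_zero.trans (HopfOreChar2.isSkewPrimitive_ι l).counit_eq_zero.symm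

theorem map_comp_comulAlgHom_of_primitive {f : UniversalEnvelopingAlgebra k L →ₐ[k] H}
    (hf : ∀ l, IsSkewPrimitive k 1 1 (f (UniversalEnvelopingAlgebra.ι k l))) :
    (Algebra.TensorProduct.map f f).comp
        (Bialgebra.comulAlgHom k (UniversalEnvelopingAlgebra k L)) =
      (Bialgebra.comulAlgHom k H).comp f := by
  refine algHom_ext fun l => ?_
  change Algebra.TensorProduct.map f f
    (Coalgebra.comul (R := k) (UniversalEnvelopingAlgebra.ι k l)) =
      Coalgebra.comul (R := k) (f (UniversalEnvelopingAlgebra.ι k l))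
  rw [hf l, HopfOreChar2.isSkewPrimitive_ι l]
  simp

end UEAHopf

/-! ### Ore extensions of enveloping algebras that are enveloping algebras -/

namespace OreExtension

variable {k : Type u} [Field k] {g : Type v} [LieRing g] [LieAlgebra k g]

local notation "U" => UniversalEnvelopingAlgebra k g
local notation "ιU" => UniversalEnvelopingAlgebra.ι k

variable {τ : UniversalEnvelopingAlgebra k g →ₐ[k] UniversalEnvelopingAlgebra k g}
  {δ : UniversalEnvelopingAlgebra k g →ₗ[k] UniversalEnvelopingAlgebra k g}

/-- The elements satisfying the Ore relation form a subalgebra by the twisted Leibniz rule, so the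
relation need only be checked on `g`. -/
theorem forall_ore_relation (hδ : ∀ a b, δ (a * b) = τ a * δ b + δ a * b) {H : Type w} [Ring H]
    [Algebra k H] (f : U →ₐ[k] H) (ζ : H)
    (h : ∀ u : g, ζ * f (ιU u) = f (τ (ιU u)) * ζ + f (δ (ιU u))) (a : U) :
    ζ * f a = f (τ a) * ζ + f (δ a) := by
  have h1 : δ 1 = 0 := by simpa using hδ 1 1
  let S : Subalgebra k U :=
    { carrier := {a | ζ * f a = f (τ a) * ζ + f (δ a)}
      mul_mem' := by
        intro p q hp hq
        simp only [Set.mem_ofPred_eq] at hp hq ⊢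
        rw [map_mul f, ← mul_assoc, hp, add_mul, mul_assoc, hq, map_mul τ, map_mul f, hδ,
          map_add f, map_mul f, map_mul f, mul_add, ← mul_assoc, add_assoc]
      add_mem' := by
        intro p q hp hq
        simp only [Set.mem_ofPred_eq] at hp hq ⊢
        simp only [map_add, mul_add, add_mul, hp, hq]
        abel
      algebraMap_mem' := by
        intro c
        simp only [Set.mem_ofPred_eq]
        have hc : δ (algebraMap k U c) = 0 := by
          rw [Algebra.algebraMap_eq_smul_one, map_smul, h1, smul_zero]
        rw [hc, map_zero, add_zero, AlgHom.commutes τ, AlgHom.commutes f, Algebra.commutes] }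
  exact UEAHopf.mem_of_forall_ι S h a

/-- The algebra map `U(g) → U(L)` induced by a Lie algebra map `g → L`. -/
def mapEnveloping {L : Type t} [LieRing L] [LieAlgebra k L] (j : g →ₗ⁅k⁆ L) :
    U →ₐ[k] UniversalEnvelopingAlgebra k L :=
  UniversalEnvelopingAlgebra.lift k ((UniversalEnvelopingAlgebra.ι k).comp j)

theorem mapEnveloping_ι {L : Type t} [LieRing L] [LieAlgebra k L] (j : g →ₗ⁅k⁆ L) (u : g) :
    mapEnveloping j (ιU u) = UniversalEnvelopingAlgebra.ι k (j u) :=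
  UniversalEnvelopingAlgebra.lift_ι_apply _ _ _

/-- An Ore extension of `U(g)` generated by a Lie algebra `L` spanned by `g` and `z` is `U(L)`. -/
def equivEnveloping (hδ : ∀ a b, δ (a * b) = τ a * δ b + δ a * b)
    {L : Type t} [LieRing L] [LieAlgebra k L] (j : g →ₗ⁅k⁆ L) (ζ : L)
    (hrel : ∀ u : g, UniversalEnvelopingAlgebra.ι k ζ * mapEnveloping j (ιU u) =
      mapEnveloping j (τ (ιU u)) * UniversalEnvelopingAlgebra.ι k ζ + mapEnveloping j (δ (ιU u)))
    (G : L →ₗ⁅k⁆ OreExtension τ δ) (hGj : ∀ u, G (j u) = of τ δ (ιU u)) (hGζ : G ζ = z τ δ)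
    (hspan : ∀ l : L, ∃ (u : g) (c : k), l = j u + c • ζ) :
    OreExtension τ δ ≃ₐ[k] UniversalEnvelopingAlgebra k L :=
  AlgEquiv.ofAlgHom
    (lift (mapEnveloping j) (UniversalEnvelopingAlgebra.ι k ζ) (forall_ore_relation hδ _ _ hrel))
    (UniversalEnvelopingAlgebra.lift k G)
    (UEAHopf.algHom_ext fun l => by
      obtain ⟨u, c, rfl⟩ := hspan l
      rw [AlgHom.comp_apply, UniversalEnvelopingAlgebra.lift_ι_apply, map_add, map_smul, hGj, hGζ,
        map_add, map_smul, lift_of, lift_z, mapEnveloping_ι]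
      simp)
    (hom_ext
      (fun a => by
        rw [AlgHom.comp_apply, lift_of]
        change ((UniversalEnvelopingAlgebra.lift k G).comp (mapEnveloping j)) a = of τ δ a
        refine DFunLike.congr_fun (UEAHopf.algHom_ext fun u => ?_) a
        rw [AlgHom.comp_apply, mapEnveloping_ι, UniversalEnvelopingAlgebra.lift_ι_apply, hGj])
      (by
        rw [AlgHom.comp_apply, lift_z, UniversalEnvelopingAlgebra.lift_ι_apply, hGζ]
        rfl))

section

variable (τ δ) in
/-- The linear map `(u, c) ↦ u + c z`. -/
def affine : g × k →ₗ[k] OreExtension τ δ :=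
  LinearMap.coprod ((of τ δ).toLinearMap ∘ₗ (UniversalEnvelopingAlgebra.ι k : g →ₗ⁅k⁆ U).toLinearMap)
    (LinearMap.toSpanSingleton k _ (z τ δ))

theorem affine_apply (p : g × k) : affine τ δ p = of τ δ (ιU p.1) + p.2 • z τ δ := rfl

variable {χ : g → k} (hτ : ∀ u : g, τ (UniversalEnvelopingAlgebra.ι k u) =
    UniversalEnvelopingAlgebra.ι k u + χ u • (1 : UniversalEnvelopingAlgebra k g)) {d : g → g}
  (hd : ∀ u : g, δ (UniversalEnvelopingAlgebra.ι k u) = UniversalEnvelopingAlgebra.ι k (d u))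

include hτ hd

theorem z_mul_of_ι (u : g) : z τ δ * of τ δ (ιU u) - of τ δ (ιU u) * z τ δ =
    affine τ δ (d u, χ u) := by
  rw [z_mul_of, hτ, hd, map_add, map_smul, map_one, add_mul, smul_one_mul, affine_apply]
  abel

/-- It shows that `g + kz` is closed under commutators. The Jacobi identity is inherited from the
associative algebra, so none has to be proved for `d` and `χ`. -/
theorem affine_lie (p q : g × k) : ⁅affine τ δ p, affine τ δ q⁆ =
    affine τ δ (⁅p.1, q.1⁆, 0) + p.2 • affine τ δ (d q.1, χ q.1) -
      q.2 • affine τ δ (d p.1, χ p.1) := by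
  rw [← z_mul_of_ι hτ hd, ← z_mul_of_ι hτ hd]
  simp only [affine_apply, LieRing.of_associative_ring_bracket, LieHom.map_lie, map_sub, map_mul,
    add_mul, mul_add, smul_mul_assoc, mul_smul_comm, smul_sub, smul_add, zero_smul, add_zero,
    smul_comm p.2 q.2]
  abel

/-- The Lie subalgebra of the Ore extension spanned by `g` and `z`. -/
def affineSubalgebra : LieSubalgebra k (OreExtension τ δ) :=
  { LinearMap.range (affine τ δ) with
    lie_mem' := by
      rintro _ _ ⟨p, rfl⟩ ⟨q, rfl⟩
      rw [affine_lie hτ hd, ← map_smul, ← map_smul, ← map_add, ← map_sub]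
      exact ⟨_, rfl⟩ }

/-- The embedding of `g` in the Lie subalgebra spanned by `g` and `z`. -/
def affineIncl : g →ₗ⁅k⁆ affineSubalgebra hτ hd where
  toFun u := ⟨of τ δ (ιU u), (u, 0), by simp [affine_apply]⟩
  map_add' u v := Subtype.ext (by simp)
  map_smul' c u := Subtype.ext (by simp)
  map_lie' {u v} := Subtype.ext (by
    simp [LieRing.of_associative_ring_bracket])

/-- The variable as an element of the Lie subalgebra spanned by `g` and `z`. -/
def affineVar : affineSubalgebra hτ hd := ⟨z τ δ, (0, 1), by simp [affine_apply]⟩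

theorem affineSubalgebra_span (l : affineSubalgebra hτ hd) :
    ∃ (u : g) (c : k), l = affineIncl hτ hd u + c • affineVar hτ hd := by
  obtain ⟨_, p, rfl⟩ := l
  exact ⟨p.1, p.2, rfl⟩

theorem affineVar_relation (u : g) : UniversalEnvelopingAlgebra.ι k (affineVar hτ hd) *
      mapEnveloping (affineIncl hτ hd) (ιU u) =
    mapEnveloping (affineIncl hτ hd) (τ (ιU u)) * UniversalEnvelopingAlgebra.ι k (affineVar hτ hd) +
      mapEnveloping (affineIncl hτ hd) (δ (ιU u)) := by
  have h : ⁅affineVar hτ hd, affineIncl hτ hd u⁆ =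
      affineIncl hτ hd (d u) + χ u • affineVar hτ hd :=
    Subtype.ext (z_mul_of_ι hτ hd u)
  have h' := congrArg (UniversalEnvelopingAlgebra.ι k) h
  rw [LieHom.map_lie, LieRing.of_associative_ring_bracket, sub_eq_iff_eq_add, map_add,
    map_smul] at h'
  rw [hτ, hd, map_add, map_smul, map_one, mapEnveloping_ι, mapEnveloping_ι, h', add_mul,
    smul_one_mul]
  abel

/-- The Ore extension is the enveloping algebra of the Lie subalgebra spanned by `g` and `z`. -/
def equivEnvelopingAffine (hδ : ∀ a b, δ (a * b) = τ a * δ b + δ a * b) :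
    OreExtension τ δ ≃ₐ[k] UniversalEnvelopingAlgebra k (affineSubalgebra hτ hd) :=
  equivEnveloping hδ (affineIncl hτ hd) (affineVar hτ hd) (affineVar_relation hτ hd)
    (affineSubalgebra hτ hd).incl (fun _ => rfl) rfl (affineSubalgebra_span hτ hd)

theorem equivEnvelopingAffine_of_ι (hδ : ∀ a b, δ (a * b) = τ a * δ b + δ a * b) (u : g) :
    equivEnvelopingAffine hτ hd hδ (of τ δ (ιU u)) =
      UniversalEnvelopingAlgebra.ι k (affineIncl hτ hd u) :=
  (lift_of _ _ _ _).trans (mapEnveloping_ι _ _)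

theorem equivEnvelopingAffine_z (hδ : ∀ a b, δ (a * b) = τ a * δ b + δ a * b) :
    equivEnvelopingAffine hτ hd hδ (z τ δ) = UniversalEnvelopingAlgebra.ι k (affineVar hτ hd) :=
  lift_z _ _ _

theorem equivEnvelopingAffine_symm_ι (hδ : ∀ a b, δ (a * b) = τ a * δ b + δ a * b)
    (l : affineSubalgebra hτ hd) :
    (equivEnvelopingAffine hτ hd hδ).symm (UniversalEnvelopingAlgebra.ι k l) = l :=
  UniversalEnvelopingAlgebra.lift_ι_apply _ _ _

end

end OreExtension

namespace TwoDimEnveloping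

variable {k : Type u} [Field k] {g : Type v} [LieRing g] [LieAlgebra k g]
  {B : Module.Basis (Fin 2) k g} {c : k}

theorem ι_injective (hB : ⁅B 0, B 1⁆ = c • B 0) :
    Function.Injective (UniversalEnvelopingAlgebra.ι k : g → UniversalEnvelopingAlgebra k g) := by
  intro u v h
  rw [basis_expand B u, basis_expand B v] at h ⊢
  simp only [map_add, map_smul] at h
  have h0 := congrArg (coeff hB (1, 0)) h
  have h1 := congrArg (coeff hB (0, 1)) h
  simp only [map_add, map_smul, coeff_ι_zero, coeff_ι_one] at h0 h1
  simp only [Prod.mk.injEq, and_self, one_ne_zero, zero_ne_one, if_true, if_false,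
    smul_eq_mul, mul_one, mul_zero, add_zero, zero_add] at h0 h1
  rw [h0, h1]

/-- The coordinates at `1` and `z` recover both components; this gives dimension 3 for `g + kz`. -/
theorem affine_injective (hB : ⁅B 0, B 1⁆ = c • B 0)
    {τ : UniversalEnvelopingAlgebra k g →ₐ[k] UniversalEnvelopingAlgebra k g}
    {δ : UniversalEnvelopingAlgebra k g →ₗ[k] UniversalEnvelopingAlgebra k g}
    (hδ : ∀ a b, δ (a * b) = τ a * δ b + δ a * b) :
    Function.Injective (OreExtension.affine τ δ) := by
  refine (injective_iff_map_eq_zero _).mpr fun p hp => ?_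
  rw [OreExtension.affine_apply] at hp
  have h := congrArg (OreExtension.trunc hδ) hp
  rw [map_add, map_smul, ← one_mul (OreExtension.z τ δ), ← map_one (OreExtension.of τ δ),
    OreExtension.trunc_of_mul_z, OreExtension.trunc_of, map_zero] at h
  have h1 := congrArg Prod.fst h
  have h2 := congrArg (fun q => Coalgebra.counit (R := k) q.2) h
  simp only [Prod.fst_add, Prod.smul_fst, smul_zero, add_zero, Prod.fst_zero] at h1
  rw [← map_zero (UniversalEnvelopingAlgebra.ι k)] at h1
  exact Prod.ext (ι_injective hB h1) (by simpa using h2)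

end TwoDimEnveloping

/-! ### Extensions with `δ(g) ⊆ g` and three-dimensional Lie algebras -/

namespace HopfOreChar2

open OreExtension TwoDimEnveloping

variable {k : Type u} [Field k] {g : Type v} [LieRing g] [LieAlgebra k g]

local notation "U" => UniversalEnvelopingAlgebra k g
local notation "ιU" => UniversalEnvelopingAlgebra.ι k

theorem exists_isEnvelopingOf [CharP k 2] {B : Module.Basis (Fin 2) k g} {c : k}
    (hB : ⁅B 0, B 1⁆ = c • B 0) (E : GeneralizedHopfOreExtension.{u, max u v, w} k U)
    (hx : E.x = 0) (hE : PreservesLie E) :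
    ∃ (L : Type (max u v)) (_ : LieRing L) (_ : LieAlgebra k L) (j : g →ₗ⁅k⁆ L),
      Module.finrank k L = 3 ∧ Function.Injective j ∧ IsEnvelopingOf E j := by
  have h₁ := r₁_eq_one hB (E := E)
  have h₂ := r₂_eq_one hB (E := E)
  have hτ := τ_ι h₁ h₂ (E := E)
  choose d hd using hE
  have hfin : Module.finrank k g = 2 := by simpa using Module.finrank_eq_card_basis B
  have : Module.Finite k g := Module.Finite.of_basis B
  refine ⟨affineSubalgebra hτ hd, inferInstance, inferInstance, affineIncl hτ hd, ?_, ?_, ?_⟩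
  · have h := LinearMap.finrank_range_of_inj (affine_injective hB E.δ_mul)
    rw [Module.finrank_prod, hfin, Module.finrank_self] at h
    exact h
  · intro u v h
    have h' : affine E.τ E.δ (u, 0) = affine E.τ E.δ (v, 0) := by
      have h1 : of E.τ E.δ (ιU u) = of E.τ E.δ (ιU v) := congrArg Subtype.val h
      rw [affine_apply, affine_apply, h1]
    exact congrArg Prod.fst (affine_injective hB E.δ_mul h')
  · let f : UniversalEnvelopingAlgebra k (affineSubalgebra hτ hd) ≃ₐ[k] E.carrier :=
      (equivEnvelopingAffine hτ hd E.δ_mul).symm.trans E.e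
    have hι : ∀ u : g, IsSkewPrimitive k 1 1 (E.incl (ιU u)) := by
      intro u
      rw [IsSkewPrimitive, E.comul_incl, isSkewPrimitive_ι u]
      simp
    have hvar : IsSkewPrimitive k 1 1 E.var := by
      rw [IsSkewPrimitive, E.comul_var, h₁, h₂, hx, map_zero, TensorProduct.zero_tmul, add_zero,
        map_one]
    have hf : ∀ l, IsSkewPrimitive k 1 1 (f (UniversalEnvelopingAlgebra.ι k l)) := by
      rintro ⟨_, p, rfl⟩
      have h : f (UniversalEnvelopingAlgebra.ι k ⟨affine E.τ E.δ p, p, rfl⟩) =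
          E.incl (ιU p.1) + p.2 • E.var := by
        change E.e ((equivEnvelopingAffine hτ hd E.δ_mul).symm _) = _
        rw [equivEnvelopingAffine_symm_ι]
        change E.e (affine E.τ E.δ p) = _
        rw [affine_apply, map_add, map_smul]
        rfl
      rw [h]
      exact (hι _).add (hvar.smul _)
    let F : UniversalEnvelopingAlgebra k (affineSubalgebra hτ hd) ≃ₐc[k] E.carrier :=
      BialgEquiv.ofAlgEquiv f (UEAHopf.counitAlgHom_comp_of_primitive (f := f.toAlgHom) hf)
        (UEAHopf.map_comp_comulAlgHom_of_primitive (f := f.toAlgHom) hf)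
    refine ⟨F.symm, fun u => ?_⟩
    have h : E.incl (ιU u) = F (UniversalEnvelopingAlgebra.ι k (affineIncl hτ hd u)) := by
      change _ = E.e ((equivEnvelopingAffine hτ hd E.δ_mul).symm _)
      rw [equivEnvelopingAffine_symm_ι]
      rfl
    rw [h]
    exact F.toEquiv.symm_apply_apply _

/-- The generalized Hopf-Ore extension given by a twist and a derivation that preserve `g ⊕ k`. -/
def ofPreservesLie {τ : U →ₐ[k] U} {δ : U →ₗ[k] U}
    (hδ : ∀ a b, δ (a * b) = τ a * δ b + δ a * b)
    {χ : g → k} (hτ : ∀ u : g, τ (ιU u) = ιU u + χ u • (1 : U)) {d : g → g}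
    (hd : ∀ u : g, δ (ιU u) = ιU (d u)) :
    GeneralizedHopfOreExtension.{u, max u v, max u v} k (UniversalEnvelopingAlgebra k g) :=
  have hf : ∀ u : g, IsSkewPrimitive k 1 1
      (((equivEnvelopingAffine hτ hd hδ).toAlgHom.comp (of τ δ)) (ιU u)) := fun u => by
    change IsSkewPrimitive k 1 1 (equivEnvelopingAffine hτ hd hδ (of τ δ (ιU u)))
    rw [equivEnvelopingAffine_of_ι]
    exact HopfOreChar2.isSkewPrimitive_ι _
  { τ := τ
    δ := δ
    δ_mul := hδ
    carrier := UniversalEnvelopingAlgebra k (affineSubalgebra hτ hd)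
    e := equivEnvelopingAffine hτ hd hδ
    r₁ := 1
    r₂ := 1
    x := 0
    y := 0
    counit_of := DFunLike.congr_fun (UEAHopf.counitAlgHom_comp_of_primitive hf)
    comul_of := fun a =>
      (DFunLike.congr_fun (UEAHopf.map_comp_comulAlgHom_of_primitive hf) a).symm
    comul_z := by
      rw [equivEnvelopingAffine_z, map_zero, map_zero, map_one, map_one, TensorProduct.zero_tmul,
        add_zero]
      exact HopfOreChar2.isSkewPrimitive_ι _ }

/-- A linear map that is compatible with the bracket, as expressed in `U(g)`, extends to a
`τ`-derivation. -/
theorem exists_twisted_derivation {τ : U →ₐ[k] U} (d : g →ₗ[k] g)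
    (hd : ∀ u v : g, ιU (d ⁅u, v⁆) = τ (ιU u) * ιU (d v) + ιU (d u) * ιU v -
      (τ (ιU v) * ιU (d u) + ιU (d v) * (ιU u : U))) :
    ∃ δ : U →ₗ[k] U, (∀ a b, δ (a * b) = τ a * δ b + δ a * b) ∧ ∀ u, δ (ιU u) = ιU (d u) := by
  -- Upper triangular matrices with diagonal `(τ(w), w)` multiply so that the corner entry obeys the
  -- twisted Leibniz rule; an algebra map into them therefore encodes a `τ`-derivation.
  let f : g →ₗ⁅k⁆ Matrix (Fin 2) (Fin 2) U :=
    { toFun := fun u => !![τ (ιU u), ιU (d u); 0, ιU u]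
      map_add' := by
        intro u v
        ext i j
        fin_cases i <;> fin_cases j <;> simp
      map_smul' := by
        intro r u
        ext i j
        fin_cases i <;> fin_cases j <;> simp
      map_lie' := by
        intro u v
        rw [LieRing.of_associative_ring_bracket, hd]
        ext i j
        fin_cases i <;> fin_cases j <;>
          simp [LieRing.of_associative_ring_bracket] }
  let F := UniversalEnvelopingAlgebra.lift k f
  have hF : ∀ u : g, F (ιU u) = !![τ (ιU u), ιU (d u); 0, ιU u] :=
    UniversalEnvelopingAlgebra.lift_ι_apply k f
  let S : Subalgebra k U :=
    { carrier := {w | F w 0 0 = τ w ∧ F w 1 0 = 0 ∧ F w 1 1 = w}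
      mul_mem' := by
        rintro p q ⟨hp, hp', hp''⟩ ⟨hq, hq', hq''⟩
        simp [Matrix.mul_apply, Fin.sum_univ_two, hp, hp', hp'', hq, hq', hq'']
      add_mem' := by
        rintro p q ⟨hp, hp', hp''⟩ ⟨hq, hq', hq''⟩
        simp [hp, hp', hp'', hq, hq', hq'']
      algebraMap_mem' := by
        intro r
        simp [Matrix.algebraMap_matrix_apply] }
  have hS : ∀ w : U, F w 0 0 = τ w ∧ F w 1 0 = 0 ∧ F w 1 1 = w := fun w =>
    UEAHopf.mem_of_forall_ι S (fun u => by
      change F (ιU u) 0 0 = τ (ιU u) ∧ F (ιU u) 1 0 = 0 ∧ F (ιU u) 1 1 = ιU u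
      rw [hF]
      simp) w
  refine ⟨{ toFun := fun w => F w 0 1, map_add' := by simp, map_smul' := by simp }, ?_, ?_⟩
  · intro a b
    change F (a * b) 0 1 = τ a * F b 0 1 + F a 0 1 * b
    rw [map_mul, Matrix.mul_apply, Fin.sum_univ_two, (hS a).1, (hS b).2.2]
  · intro u
    change F (ιU u) 0 1 = ιU (d u)
    rw [hF]
    simp

/-- For `ζ` in `L` outside `j(g)`, write `[ζ, j(u)] = j(d(u)) + χ(u) ζ`. The Jacobi identity makes
`χ` vanish on brackets and `d` a twisted derivation, so both extend to `U(g)` and give the Ore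
extension. -/
theorem exists_familyA_isEnvelopingOf [CharP k 2] {B : Module.Basis (Fin 2) k g} {c : k}
    (hB : ⁅B 0, B 1⁆ = c • B 0) {L : Type t} [LieRing L] [LieAlgebra k L] (j : g →ₗ⁅k⁆ L)
    (hL : Module.finrank k L = 3) (hj : Function.Injective j) :
    ∃ E : GeneralizedHopfOreExtension.{u, max u v, max u v} k U,
      FamilyA (B 0) (B 1) E ∧ PreservesLie E ∧ IsEnvelopingOf E j := by
  have hfin : Module.finrank k g = 2 := by simpa using Module.finrank_eq_card_basis B
  have : Module.Finite k g := Module.Finite.of_basis B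
  have : Module.Finite k L := Module.finite_of_finrank_eq_succ hL
  obtain ⟨ζ, hζ⟩ : ∃ ζ : L, ζ ∉ LinearMap.range j.toLinearMap := by
    by_contra h
    push Not at h
    have h' := LinearMap.finrank_range_of_inj (f := j.toLinearMap) hj
    rw [(Submodule.eq_top_iff'.mpr h), finrank_top] at h'
    omega
  let Φ₀ : g × k →ₗ[k] L := LinearMap.coprod j.toLinearMap (LinearMap.toSpanSingleton k L ζ)
  have hΦ₀ : ∀ p, Φ₀ p = j p.1 + p.2 • ζ := fun p => rfl
  have hinj : Function.Injective Φ₀ := by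
    refine (injective_iff_map_eq_zero _).mpr fun p hp => ?_
    rw [hΦ₀] at hp
    have h2 : p.2 = 0 := by
      by_contra h2
      refine hζ ⟨-(p.2)⁻¹ • p.1, ?_⟩
      change j (-(p.2)⁻¹ • p.1) = ζ
      rw [map_smul, eq_neg_of_add_eq_zero_left hp, neg_smul, smul_neg, neg_neg, smul_smul,
        inv_mul_cancel₀ h2, one_smul]
    rw [h2, zero_smul, add_zero] at hp
    exact Prod.ext (hj (by rw [hp, Prod.fst_zero, map_zero])) h2
  let Φ : (g × k) ≃ₗ[k] L := LinearMap.linearEquivOfInjective Φ₀ hinj (by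
    rw [Module.finrank_prod, hfin, Module.finrank_self, hL])
  have hΦ : ∀ p, Φ p = j p.1 + p.2 • ζ := fun p => rfl
  let D : g →ₗ[k] g × k :=
    Φ.symm.toLinearMap ∘ₗ (LieAlgebra.ad k L ζ) ∘ₗ j.toLinearMap
  have hD : ∀ u, ⁅ζ, j u⁆ = j (D u).1 + (D u).2 • ζ := fun u => by
    rw [← hΦ]
    exact (Φ.apply_symm_apply ⁅ζ, j u⁆).symm
  have hDlie : ∀ u v, D ⁅u, v⁆ = (⁅(D u).1, v⁆ + ⁅u, (D v).1⁆ + (D u).2 • (D v).1 -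
      -- The second component is `0` because the two terms `χ(u) χ(v) ζ` cancel; hence `u ↦ χ(u)` is
      -- a character of `g`.
      (D v).2 • (D u).1, 0) := by
    intro u v
    apply Φ.injective
    rw [hΦ, hΦ, ← hD, LieHom.map_lie, leibniz_lie, hD u, hD v]
    have h : ⁅j u, ζ⁆ = -(j (D u).1 + (D u).2 • ζ) := by rw [← lie_skew, hD]
    simp only [add_lie, lie_add, smul_lie, lie_smul, hD v, h, map_add, map_sub, map_smul,
      LieHom.map_lie]
    module
  -- This Lie map is the restriction of `τ` to `g`; the scalar character is its second term.
  let χ : g →ₗ⁅k⁆ U :=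
    { toFun := fun u => ιU u + (D u).2 • (1 : U)
      map_add' := by
        intro u v
        simp only [map_add, Prod.snd_add]
        module
      map_smul' := by
        intro r u
        simp only [map_smul, Prod.smul_snd, smul_eq_mul, RingHom.id_apply]
        module
      map_lie' := by
        intro u v
        rw [hDlie, LieHom.map_lie]
        simp only [LieRing.of_associative_ring_bracket, zero_smul, add_zero, add_mul, mul_add,
          smul_mul_assoc, mul_smul_comm, one_mul, mul_one]
        module }
  let τ : U →ₐ[k] U := UniversalEnvelopingAlgebra.lift k χ
  have hτ : ∀ u : g, τ (ιU u) = ιU u + (D u).2 • (1 : U) :=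
    UniversalEnvelopingAlgebra.lift_ι_apply k χ
  obtain ⟨δ, hδ, hd⟩ := exists_twisted_derivation (τ := τ) (LinearMap.fst k g k ∘ₗ D) (by
    intro u v
    simp only [LinearMap.comp_apply, LinearMap.fst_apply, hDlie, hτ, map_add, map_sub, map_smul,
      LieHom.map_lie, LieRing.of_associative_ring_bracket, add_mul, smul_mul_assoc, one_mul]
    abel)
  have hd' : ∀ u : g, δ (ιU u) = ιU (D u).1 := hd
  let G : L →ₗ⁅k⁆ OreExtension τ δ :=
    { affine τ δ ∘ₗ Φ.symm.toLinearMap with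
      map_lie' := by
        intro l m
        obtain ⟨p, rfl⟩ := Φ.surjective l
        obtain ⟨q, rfl⟩ := Φ.surjective m
        change affine τ δ (Φ.symm ⁅Φ p, Φ q⁆) =
          ⁅affine τ δ (Φ.symm (Φ p)), affine τ δ (Φ.symm (Φ q))⁆
        rw [Φ.symm_apply_apply, Φ.symm_apply_apply, affine_lie hτ hd',
          ← map_smul (affine τ δ), ← map_smul (affine τ δ), ← map_add (affine τ δ),
          ← map_sub (affine τ δ)]
        congr 1
        rw [LinearEquiv.symm_apply_eq, map_sub, map_add, map_smul, map_smul]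
        have h : ∀ u, ⁅j u, ζ⁆ = -(j (D u).1 + (D u).2 • ζ) := fun u => by rw [← lie_skew, hD]
        simp only [hΦ, add_lie, lie_add, smul_lie, lie_smul, hD, h, LieHom.map_lie, lie_self]
        module }
  have hG : ∀ p, G (Φ p) = affine τ δ p := fun p => by
    change affine τ δ (Φ.symm (Φ p)) = _
    rw [Φ.symm_apply_apply]
  have hrel : ∀ u : g, UniversalEnvelopingAlgebra.ι k ζ * mapEnveloping j (ιU u) =
      mapEnveloping j (τ (ιU u)) * UniversalEnvelopingAlgebra.ι k ζ +
        mapEnveloping j (δ (ιU u)) := by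
    intro u
    have h := congrArg (UniversalEnvelopingAlgebra.ι k) (hD u)
    rw [LieHom.map_lie, LieRing.of_associative_ring_bracket, sub_eq_iff_eq_add, map_add,
      map_smul] at h
    rw [hτ, hd', map_add, map_smul, map_one, mapEnveloping_ι, mapEnveloping_ι, h, add_mul,
      smul_one_mul]
    abel
  let e : OreExtension τ δ ≃ₐ[k] UniversalEnvelopingAlgebra k L :=
    equivEnveloping hδ j ζ hrel G
      (fun u => by
        have h := hG (u, 0)
        rw [hΦ, affine_apply] at h
        simpa using h)
      (by
        have h := hG (0, 1)
        rw [hΦ, affine_apply] at h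
        simpa using h)
      (fun l => ⟨(Φ.symm l).1, (Φ.symm l).2, by rw [← hΦ, Φ.apply_symm_apply]⟩)
  have he_of : ∀ u : g, e (of τ δ (ιU u)) = UniversalEnvelopingAlgebra.ι k (j u) := fun u =>
    (lift_of _ _ _ _).trans (mapEnveloping_ι _ _)
  have he_z : e (z τ δ) = UniversalEnvelopingAlgebra.ι k ζ := lift_z _ _ _
  -- The carrier is the enveloping algebra of `g + kz`, not `U(L)`, because `L` may lie in another
  -- universe; the isomorphism with `U(L)` passes through the Ore extension.
  refine ⟨ofPreservesLie hδ hτ hd', familyA_of_eq_zero hB rfl rfl, fun u => ⟨_, hd' u⟩, ?_⟩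
  let f : UniversalEnvelopingAlgebra k (affineSubalgebra hτ hd') ≃ₐ[k]
      UniversalEnvelopingAlgebra k L := (equivEnvelopingAffine hτ hd' hδ).symm.trans e
  have hf : ∀ l, IsSkewPrimitive k 1 1 (f (UniversalEnvelopingAlgebra.ι k l)) := by
    rintro ⟨_, p, rfl⟩
    change IsSkewPrimitive k 1 1 (e ((equivEnvelopingAffine hτ hd' hδ).symm _))
    rw [equivEnvelopingAffine_symm_ι]
    change IsSkewPrimitive k 1 1 (e (affine τ δ p))
    rw [affine_apply, map_add, map_smul, he_of, he_z, ← map_smul,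
      ← map_add]
    exact HopfOreChar2.isSkewPrimitive_ι _
  refine ⟨BialgEquiv.ofAlgEquiv f (UEAHopf.counitAlgHom_comp_of_primitive (f := f.toAlgHom) hf)
    (UEAHopf.map_comp_comulAlgHom_of_primitive (f := f.toAlgHom) hf), fun u => ?_⟩
  change e ((equivEnvelopingAffine hτ hd' hδ).symm
    (equivEnvelopingAffine hτ hd' hδ (of τ δ (ιU u)))) = _
  rw [AlgEquiv.symm_apply_apply, he_of]

end HopfOreChar2

/-- A two-dimensional Lie algebra has a basis `a, b` with `[a, b] = 0` or `[a, b] = a`. -/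
theorem LieAlgebra.exists_basis_of_finrank_eq_two {k : Type u} [Field k] {g : Type v} [LieRing g]
    [LieAlgebra k g] (hg : Module.finrank k g = 2) :
    ∃ B : Module.Basis (Fin 2) k g, ⁅B 0, B 1⁆ = 0 ∨ ⁅B 0, B 1⁆ = B 0 := by
  have : Module.Finite k g := Module.finite_of_finrank_eq_succ hg
  -- Take `a = [u,v]` and `b = r⁻¹ v`: then `[a,b] = r r⁻¹ [u,v] = a`. If the first coefficient is
  -- zero, the roles of `u` and `v` are exchanged.
  have key : ∀ u v : g, ∀ r s : k, LinearIndependent k ![u, v] → ⁅u, v⁆ = r • u + s • v → r ≠ 0 →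
      ∃ B : Module.Basis (Fin 2) k g, ⁅B 0, B 1⁆ = B 0 := by
    intro u v r s hlin huv hr
    have hlin' : LinearIndependent k ![r • u + s • v, r⁻¹ • v] := by
      rw [LinearIndependent.pair_iff] at hlin ⊢
      intro p q h
      obtain ⟨h1, h2⟩ := hlin (p * r) (p * s + q * r⁻¹) (by rw [← h]; module)
      have hp : p = 0 := (mul_eq_zero.mp h1).resolve_right hr
      rw [hp, zero_mul, zero_add] at h2
      exact ⟨hp, (mul_eq_zero.mp h2).resolve_right (inv_ne_zero hr)⟩
    refine ⟨basisOfLinearIndependentOfCardEqFinrank hlin' (by simp [hg]), ?_⟩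
    simp only [coe_basisOfLinearIndependentOfCardEqFinrank, Matrix.cons_val_zero,
      Matrix.cons_val_one]
    rw [lie_smul, add_lie, smul_lie, smul_lie, lie_self, smul_zero, add_zero, smul_smul,
      inv_mul_cancel₀ hr, one_smul, huv]
  let B := Module.finBasisOfFinrankEq k g hg
  have hlin : LinearIndependent k ![B 0, B 1] := by
    have h : ![B 0, B 1] = B := by
      ext i
      fin_cases i <;> rfl
    rw [h]
    exact B.linearIndependent
  have hlin' : LinearIndependent k ![B 1, B 0] := by
    rw [LinearIndependent.pair_symm_iff]
    exact hlin
  have hexp := TwoDimEnveloping.basis_expand B ⁅B 0, B 1⁆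
  by_cases hr : B.repr ⁅B 0, B 1⁆ 0 = 0
  · by_cases hs : B.repr ⁅B 0, B 1⁆ 1 = 0
    · refine ⟨B, Or.inl ?_⟩
      rw [hexp, hr, hs, zero_smul, zero_smul, add_zero]
    · obtain ⟨B', hB'⟩ := key (B 1) (B 0) (-B.repr ⁅B 0, B 1⁆ 1) (-B.repr ⁅B 0, B 1⁆ 0) hlin' (by
        rw [← lie_skew]
        nth_rewrite 1 [hexp]
        module) (neg_ne_zero.mpr hs)
      exact ⟨B', Or.inr hB'⟩
  · obtain ⟨B', hB'⟩ := key _ _ _ _ hlin hexp hr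
    exact ⟨B', Or.inr hB'⟩

end

theorem proposition2p14 {k : Type u} [Field k] [CharP k 2]
    {g : Type v} [LieRing g] [LieAlgebra k g] (hg : Module.finrank k g = 2) :
    (∀ E : GeneralizedHopfOreExtension.{u, max u v, w} k (UniversalEnvelopingAlgebra k g),
      E.r₁ = 1 ∧ E.r₂ = 1 ∧
        (E.IsNormalized → E.x ∈ restrictedHull k g 2 ∧ E.y ∈ restrictedHull k g 2)) ∧
    (∃ B : Module.Basis (Fin 2) k g, ⁅B 0, B 1⁆ = 0 ∨ ⁅B 0, B 1⁆ = B 0) ∧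
    (∀ B : Module.Basis (Fin 2) k g, (⁅B 0, B 1⁆ = 0 ∨ ⁅B 0, B 1⁆ = B 0) →
      (∀ E : GeneralizedHopfOreExtension.{u, max u v, w} k (UniversalEnvelopingAlgebra k g),
        ∃ E' : GeneralizedHopfOreExtension.{u, max u v, w} k (UniversalEnvelopingAlgebra k g),
          E.Isomorphic E' ∧
            (HopfOreChar2.FamilyA (B 0) (B 1) E' ∨ HopfOreChar2.FamilyB (B 0) (B 1) E' ∨
              HopfOreChar2.FamilyC (B 0) (B 1) E' ∨ HopfOreChar2.FamilyD (B 0) (B 1) E')) ∧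
      (∀ E : GeneralizedHopfOreExtension.{u, max u v, w} k (UniversalEnvelopingAlgebra k g),
        HopfOreChar2.FamilyA (B 0) (B 1) E → HopfOreChar2.PreservesLie E →
          ∃ (L : Type (max u v)) (_ : LieRing L) (_ : LieAlgebra k L) (j : g →ₗ⁅k⁆ L),
            Module.finrank k L = 3 ∧ Function.Injective j ∧ HopfOreChar2.IsEnvelopingOf E j) ∧
      (∀ (L : Type t) [LieRing L] [LieAlgebra k L] (j : g →ₗ⁅k⁆ L),
        Module.finrank k L = 3 → Function.Injective j →
          ∃ E : GeneralizedHopfOreExtension.{u, max u v, max u v} k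
              (UniversalEnvelopingAlgebra k g),
            HopfOreChar2.FamilyA (B 0) (B 1) E ∧ HopfOreChar2.PreservesLie E ∧
              HopfOreChar2.IsEnvelopingOf E j)) := by
  have hc : ∀ B : Module.Basis (Fin 2) k g, (⁅B 0, B 1⁆ = 0 ∨ ⁅B 0, B 1⁆ = B 0) →
      ∃ c : k, ⁅B 0, B 1⁆ = c • B 0 := by
    rintro B (h | h)
    · exact ⟨0, by rw [h, zero_smul]⟩
    · exact ⟨1, by rw [h, one_smul]⟩
  have hbasis := LieAlgebra.exists_basis_of_finrank_eq_two hg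
  refine ⟨fun E => ?_, hbasis, fun B hB => ⟨HopfOreChar2.exists_isomorphic_family hB, ?_, ?_⟩⟩
  · obtain ⟨B, hB⟩ := hbasis
    obtain ⟨c, hc⟩ := hc B hB
    have h₁ := HopfOreChar2.r₁_eq_one hc (E := E)
    have h₂ := HopfOreChar2.r₂_eq_one hc (E := E)
    refine ⟨h₁, h₂, fun hE => ⟨?_, ?_⟩⟩
    · refine TwoDimEnveloping.mem_restrictedHull_of_primitive hc ?_
      have h := hE.primitive_x
      rwa [h₂] at h
    · refine TwoDimEnveloping.mem_restrictedHull_of_primitive hc ?_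
      have h := hE.primitive_y
      rwa [h₁] at h
  · intro E hE hlie
    obtain ⟨c, hc⟩ := hc B hB
    obtain ⟨χ, hform, -⟩ := hE
    exact HopfOreChar2.exists_isEnvelopingOf hc E hform.x_eq hlie
  · intro L _ _ j hL hj
    obtain ⟨c, hc⟩ := hc B hB
    exact HopfOreChar2.exists_familyA_isEnvelopingOf hc j hL hj
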